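/- Let $n\ge 0$ be an integer. Consider independent complex variables $m_{ij}$, $1\le i\le n-1$, $1\le j\le\left[\frac{i+1}{2}\right]$, and let $e^{\pm\partial_{m_{ij}}}$ be the shift operator $m_{ij}\mapsto m_{ij}\pm1$ on functions of these variables (the other variables being fixed). Define difference operators $I_{s+1,s}$, $1\le s\le n-1$, as follows. For $k\ge 1$ with $2k\le n-1$, $$I_{2k+1,2k} = -\sum_{j=1}^{k} \frac{\prod_{r=1}^{k-1} (m_{2k-2,r} + m_{2k-1,j} +\frac{1}{2} ) \prod_{r=1}^{k} (m_{2k-1,j} - m_{2k,r} + \frac{1}{2})}{2\prod_{r \neq j} (m_{2k-1,j} - m_{2k-1,r})(m_{2k-1,j} + m_{2k-1,r}+1)} e^{ \partial_{m_{2k-1,j}}} - \sum_{j=1}^{k} \frac{\prod_{r=1}^{k-1} (m_{2k-1,j} - m_{2k-2,r}-\frac{1}{2} ) \prod_{r=1}^{k} (m_{2k,r} + m_{2k-1,j} - \frac{1}{2})}{2\prod_{r \neq j} (m_{2k-1,j} - m_{2k-1,r})(m_{2k-1,j} + m_{2k-1,r}-1)} e^{- \partial_{m_{2k-1,j}}},$$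 and for $k\ge 0$ with $2k+1\le n-1$, $$I_{2k+2,2k+1} = \sum_{j=1}^{k} \frac{\prod_{r=1}^{k+1} ((m_{2k,j}+\frac{1}{2})^2 - m_{2k+1,r}^2)}{2m_{2k,j} (m_{2k,j}+\frac{1}{2}) \prod_{r \neq j} (m^2_{2k,j} - m^2_{2k,r})} e^{ \partial_{m_{2k,j}}} + \sum_{j=1}^{k} \frac{\prod_{r=1}^{k} ((m_{2k,j}-\frac{1}{2})^2 - m_{2k-1,r}^2)}{2m_{2k,j} (m_{2k,j}-\frac{1}{2}) \prod_{r \neq j} (m^2_{2k,j} - m^2_{2k,r})} e^{-\partial_{m_{2k,j}}} + i\, \frac{\prod_{r=1}^{k} m_{2k-1,r} \prod_{r=1}^{k+1} m_{2k+1,r}}{\prod_{r=1}^{k}(m_{2k,r}+\frac{1}{2}) (m_{2k,r}-\frac{1}{2})},$$ where the products over $r\ne j$ run over $1\le r\le k$, $r\neq j$. Then these operators, acting on the space of rational functions of the $m_{ij}$ with complex coefficients, and likewise acting on the space of meromorphic functions of the $m_{ij}$, satisfy the defining relations of the generators of the orthogonal Lie algebra $so(n)$: $$[ I_{i+1,i},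 [ I_{i+2,i+1}, I_{i+1,i}] ] = I_{i+2,i+1},\qquad [ I_{i+2,i+1}, [ I_{i+1,i}, I_{i+2,i+1}] ] = I_{i+1,i}\qquad (1\le i\le n-2),$$ $$[ I_{i+1,i}, I_{j+1,j}] = 0\qquad (1\le i,j\le n-1,\ |i-j|>1).$$ -/

import Mathlib

noncomputable section

namespace GelfandTsetlinSO

/-! ### Defining relations of `so(n)`

The generator `I_{s+1,s}` is written `I s`, for `1 ≤ s ≤ n - 1`. -/

/-- The defining relations of `so(n)` for elements `I s = I_{s+1,s}`, `1 ≤ s ≤ n - 1`, of an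
associative ring with the commutator bracket `⁅a, b⁆ = a * b - b * a`; the values of `I` outside
this range play no role. -/
structure SatisfiesSoRelations {L : Type*} [Ring L] (n : ℕ) (I : ℕ → L) : Prop where
  serre_left : ∀ i, 1 ≤ i → i + 2 ≤ n → ⁅I i, ⁅I (i + 1), I i⁆⁆ = I (i + 1)
  serre_right : ∀ i, 1 ≤ i → i + 2 ≤ n → ⁅I (i + 1), ⁅I i, I (i + 1)⁆⁆ = I i
  comm : ∀ i j, 1 ≤ i → i + 1 ≤ n → 1 ≤ j → j + 1 ≤ n → 1 < |(i : ℤ) - (j : ℤ)| →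
    ⁅I i, I j⁆ = 0

/-! ### The formulas for the generators

The formulas are written over a commutative `ℂ`-algebra `A` with a division (used below for the
field of rational functions, and for the algebra of complex valued functions with pointwise
operations), with elements `m i j` of `A` for the variables `m_{ij}` and with linear operators
`T i j a` for the shifts `e^{a ∂/∂m_{ij}}`. All indices start at `1`. -/

section Formulas

variable {A : Type*} [CommRing A] [Div A] (m : ℕ → ℕ → A)

/-- Coefficient of the shift of `m_{2k-1,j}` by `+1` in `- I_{2k+1,2k}`. -/
def oddUp (k j : ℕ) : A :=
  ((∏ r ∈ Finset.Icc 1 (k - 1), (m (2 * k - 2) r + m (2 * k - 1) j + 1 / 2)) *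
      ∏ r ∈ Finset.Icc 1 k, (m (2 * k - 1) j - m (2 * k) r + 1 / 2)) /
    (2 * ∏ r ∈ (Finset.Icc 1 k).erase j,
      ((m (2 * k - 1) j - m (2 * k - 1) r) * (m (2 * k - 1) j + m (2 * k - 1) r + 1)))

/-- Coefficient of the shift of `m_{2k-1,j}` by `-1` in `- I_{2k+1,2k}`. -/
def oddDown (k j : ℕ) : A :=
  ((∏ r ∈ Finset.Icc 1 (k - 1), (m (2 * k - 1) j - m (2 * k - 2) r - 1 / 2)) *
      ∏ r ∈ Finset.Icc 1 k, (m (2 * k) r + m (2 * k - 1) j - 1 / 2)) /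
    (2 * ∏ r ∈ (Finset.Icc 1 k).erase j,
      ((m (2 * k - 1) j - m (2 * k - 1) r) * (m (2 * k - 1) j + m (2 * k - 1) r - 1)))

/-- Coefficient of the shift of `m_{2k,j}` by `+1` in `I_{2k+2,2k+1}`. -/
def evenUp (k j : ℕ) : A :=
  (∏ r ∈ Finset.Icc 1 (k + 1), ((m (2 * k) j + 1 / 2) ^ 2 - m (2 * k + 1) r ^ 2)) /
    (2 * m (2 * k) j * (m (2 * k) j + 1 / 2) *
      ∏ r ∈ (Finset.Icc 1 k).erase j, (m (2 * k) j ^ 2 - m (2 * k) r ^ 2))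

/-- Coefficient of the shift of `m_{2k,j}` by `-1` in `I_{2k+2,2k+1}`. -/
def evenDown (k j : ℕ) : A :=
  (∏ r ∈ Finset.Icc 1 k, ((m (2 * k) j - 1 / 2) ^ 2 - m (2 * k - 1) r ^ 2)) /
    (2 * m (2 * k) j * (m (2 * k) j - 1 / 2) *
      ∏ r ∈ (Finset.Icc 1 k).erase j, (m (2 * k) j ^ 2 - m (2 * k) r ^ 2))

/-- The term without a shift in `I_{2k+2,2k+1}`, divided by the imaginary unit. -/
def evenDiag (k : ℕ) : A :=
  ((∏ r ∈ Finset.Icc 1 k, m (2 * k - 1) r) * ∏ r ∈ Finset.Icc 1 (k + 1), m (2 * k + 1) r) /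
    ∏ r ∈ Finset.Icc 1 k, ((m (2 * k) r + 1 / 2) * (m (2 * k) r - 1 / 2))

variable [Algebra ℂ A] (T : ℕ → ℕ → ℂ → Module.End ℂ A)

/-- The difference operator `I_{2k+1,2k}`. -/
def genOdd (k : ℕ) : Module.End ℂ A :=
  - (∑ j ∈ Finset.Icc 1 k, LinearMap.mulLeft ℂ (oddUp m k j) * T (2 * k - 1) j 1)
  - ∑ j ∈ Finset.Icc 1 k, LinearMap.mulLeft ℂ (oddDown m k j) * T (2 * k - 1) j (-1)

/-- The difference operator `I_{2k+2,2k+1}`. -/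
def genEven (k : ℕ) : Module.End ℂ A :=
  (∑ j ∈ Finset.Icc 1 k, LinearMap.mulLeft ℂ (evenUp m k j) * T (2 * k) j 1)
  + (∑ j ∈ Finset.Icc 1 k, LinearMap.mulLeft ℂ (evenDown m k j) * T (2 * k) j (-1))
  + Complex.I • LinearMap.mulLeft ℂ (evenDiag m k)

/-- The operator `I_{s+1,s}`: it is `I_{2k+1,2k}` for `s = 2k` and `I_{2k+2,2k+1}` for
`s = 2k+1`. -/
def gen (s : ℕ) : Module.End ℂ A :=
  if Even s then genOdd m T (s / 2) else genEven m T (s / 2)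

end Formulas

/-! ### The variables -/

/-- The positions `(i, j)` in a Gelfand-Tsetlin tableau for `so(n)`: rows `i = 1, …, n - 1`, with
entries `j = 1, …, [(i+1)/2]` in row `i`. -/
abbrev Entry (n : ℕ) : Type :=
  {p : ℕ × ℕ // p ∈ (Finset.Icc 1 (n - 1) ×ˢ Finset.Icc 1 n).filter
    fun p => 2 * p.2 ≤ p.1 + 1}

/-- The bound `j ≤ n` that makes the index type visibly finite is redundant. -/
theorem entry_iff (n i j : ℕ) :
    ((i, j) ∈ (Finset.Icc 1 (n - 1) ×ˢ Finset.Icc 1 n).filter fun p => 2 * p.2 ≤ p.1 + 1) ↔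
      (1 ≤ i ∧ i + 1 ≤ n) ∧ (1 ≤ j ∧ j ≤ (i + 1) / 2) := by
  simp only [Finset.mem_filter, Finset.mem_product, Finset.mem_Icc]
  omega

/-- A family indexed by the entries of a tableau, as a function of two indices, with the value `0`
outside the tableau (these values are not used by `I_{s+1,s}`, `1 ≤ s ≤ n - 1`). -/
def extend {A : Type*} [Zero A] {n : ℕ} (x : Entry n → A) (i j : ℕ) : A :=
  if h : (i, j) ∈ (Finset.Icc 1 (n - 1) ×ˢ Finset.Icc 1 n).filter fun p => 2 * p.2 ≤ p.1 + 1
  then x ⟨(i, j), h⟩ else 0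

/-! ### Rational functions -/

/-- Polynomials in the variables `m_{ij}`. -/
abbrev Poly (n : ℕ) : Type := MvPolynomial (Entry n) ℂ

/-- Rational functions of the variables `m_{ij}`. -/
abbrev RatFun (n : ℕ) : Type := FractionRing (Poly n)

/-- The substitution `m_{ij} ↦ m_{ij} + a` (the other variables being fixed) in polynomials. -/
def shiftPoly (n i j : ℕ) (a : ℂ) : Poly n →ₐ[ℂ] Poly n :=
  MvPolynomial.aeval fun t =>
    MvPolynomial.X t + MvPolynomial.C (if t.1 = (i, j) then a else 0)

theorem shiftPoly_neg_shiftPoly (n i j : ℕ) (a : ℂ) (p : Poly n) :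
    shiftPoly n i j (-a) (shiftPoly n i j a p) = p := by
  have h : (shiftPoly n i j (-a)).comp (shiftPoly n i j a) = AlgHom.id ℂ (Poly n) := by
    apply MvPolynomial.algHom_ext
    intro t
    simp only [shiftPoly, AlgHom.comp_apply, MvPolynomial.aeval_X, map_add, AlgHom.id_apply,
      MvPolynomial.algHom_C, MvPolynomial.algebraMap_eq]
    split_ifs <;> simp
  exact DFunLike.congr_fun h p

theorem shiftPoly_injective (n i j : ℕ) (a : ℂ) : Function.Injective
    ((IsScalarTower.toAlgHom ℂ (Poly n) (RatFun n)).comp (shiftPoly n i j a)) :=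
  (IsFractionRing.injective (Poly n) (RatFun n)).comp
    (Function.LeftInverse.injective (shiftPoly_neg_shiftPoly n i j a))

/-- The shift `e^{a ∂/∂m_{ij}}` on rational functions. -/
def shiftRat (n i j : ℕ) (a : ℂ) : Module.End ℂ (RatFun n) :=
  (IsFractionRing.liftAlgHom (shiftPoly_injective n i j a) : RatFun n →ₐ[ℂ] RatFun n).toLinearMap

/-- The variable `m_{ij}` as a rational function. -/
def varRat (n : ℕ) : ℕ → ℕ → RatFun n :=
  extend fun t => algebraMap (Poly n) (RatFun n) (MvPolynomial.X t)

/-- The operator `I_{s+1,s}` on rational functions. -/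
def genRat (n s : ℕ) : Module.End ℂ (RatFun n) := gen (varRat n) (shiftRat n) s

/-! ### Meromorphic functions -/

/-- The space of complex values of the variables `m_{ij}`. -/
abbrev Space (n : ℕ) : Type := Entry n → ℂ

/-- A function `f` represents a meromorphic function if locally it is a quotient `g / h` of
analytic functions, `h` not vanishing identically on any nonempty open subset, at all points with
`h ≠ 0`. -/
def IsMero {n : ℕ} (f : Space n → ℂ) : Prop :=
  ∀ z : Space n, ∃ U : Set (Space n), IsOpen U ∧ z ∈ U ∧ ∃ g h : Space n → ℂ,
    AnalyticOnNhd ℂ g U ∧ AnalyticOnNhd ℂ h U ∧ U ⊆ closure {w | h w ≠ 0} ∧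
      ∀ w ∈ U, h w ≠ 0 → f w = g w / h w

/-- Translation of a point by `a` in the coordinate `m_{ij}`. -/
def translate {n : ℕ} (i j : ℕ) (a : ℂ) (z : Space n) : Space n :=
  fun t => z t + if t.1 = (i, j) then a else 0

/-- The shift `e^{a ∂/∂m_{ij}}` on functions. -/
def shiftFun (n i j : ℕ) (a : ℂ) : Module.End ℂ (Space n → ℂ) where
  toFun f := fun z => f (translate i j a z)
  map_add' _ _ := rfl
  map_smul' _ _ := rfl

/-- The variable `m_{ij}` as a function. -/
def varFun (n : ℕ) : ℕ → ℕ → Space n → ℂ := extend fun t z => z t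

/-- The operator `I_{s+1,s}` on functions, with pointwise operations. The values at the zeros of
the denominators are irrelevant: they disappear in the space of meromorphic functions `Mero`. -/
def genFun (n s : ℕ) : Module.End ℂ (Space n → ℂ) := gen (varFun n) (shiftFun n) s

section Closure

variable {n : ℕ}

theorem IsMero.of_analytic {f : Space n → ℂ} (hf : AnalyticOnNhd ℂ f Set.univ) : IsMero f := by
  intro z
  refine ⟨Set.univ, isOpen_univ, trivial, f, 1, hf, analyticOnNhd_const, ?_, ?_⟩
  · intro w _
    exact subset_closure (by simp)
  · simp

theorem dense_ne_inter {U : Set (Space n)} (hU : IsOpen U) {h k : Space n → ℂ}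
    (hk : AnalyticOnNhd ℂ k U) (h1 : U ⊆ closure {w | h w ≠ 0})
    (h2 : U ⊆ closure {w | k w ≠ 0}) : U ⊆ closure {w | h w * k w ≠ 0} := by
  intro w hw
  rw [mem_closure_iff]
  intro V hV hwV
  obtain ⟨x, ⟨hxV, hxU⟩, hx⟩ := mem_closure_iff.1 (h2 hw) (V ∩ U) (hV.inter hU) ⟨hwV, hw⟩
  have hev : ∀ᶠ y in nhds x, k y ≠ 0 ∧ y ∈ V :=
    ((hk x hxU).continuousAt.eventually_ne hx).and (hV.mem_nhds hxV)
  obtain ⟨W, hW, hWo, hxW⟩ := eventually_nhds_iff.1 hev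
  obtain ⟨y, hyW, hy⟩ := mem_closure_iff.1 (h1 hxU) W hWo hxW
  exact ⟨y, (hW y hyW).2, mul_ne_zero hy (hW y hyW).1⟩

theorem IsMero.common {f f' : Space n → ℂ} (hf : IsMero f) (hf' : IsMero f') (z : Space n) :
    ∃ U : Set (Space n), IsOpen U ∧ z ∈ U ∧ ∃ g h g' h' : Space n → ℂ,
      AnalyticOnNhd ℂ g U ∧ AnalyticOnNhd ℂ h U ∧ AnalyticOnNhd ℂ g' U ∧ AnalyticOnNhd ℂ h' U ∧
      U ⊆ closure {w | h w * h' w ≠ 0} ∧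
      ∀ w ∈ U, h w * h' w ≠ 0 → f w = g w / h w ∧ f' w = g' w / h' w := by
  obtain ⟨U, hU, hz, g, h, hg, hh, hd, he⟩ := hf z
  obtain ⟨U', hU', hz', g', h', hg', hh', hd', he'⟩ := hf' z
  refine ⟨U ∩ U', hU.inter hU', ⟨hz, hz'⟩, g, h, g', h', hg.mono Set.inter_subset_left,
    hh.mono Set.inter_subset_left, hg'.mono Set.inter_subset_right,
    hh'.mono Set.inter_subset_right, ?_, ?_⟩
  · exact dense_ne_inter (hU.inter hU') (hh'.mono Set.inter_subset_right)
      (Set.inter_subset_left.trans hd) (Set.inter_subset_right.trans hd')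
  · intro w hw hne
    exact ⟨he w hw.1 (left_ne_zero_of_mul hne), he' w hw.2 (right_ne_zero_of_mul hne)⟩

theorem IsMero.add {f f' : Space n → ℂ} (hf : IsMero f) (hf' : IsMero f') :
    IsMero (f + f') := by
  intro z
  obtain ⟨U, hU, hz, g, h, g', h', hg, hh, hg', hh', hd, he⟩ := hf.common hf' z
  refine ⟨U, hU, hz, g * h' + h * g', h * h', (hg.mul hh').add (hh.mul hg'), hh.mul hh', hd, ?_⟩
  intro w hw hne
  obtain ⟨e1, e2⟩ := he w hw hne
  simp only [Pi.add_apply, Pi.mul_apply, e1, e2]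
  exact div_add_div _ _ (left_ne_zero_of_mul hne) (right_ne_zero_of_mul hne)

theorem IsMero.mul {f f' : Space n → ℂ} (hf : IsMero f) (hf' : IsMero f') :
    IsMero (f * f') := by
  intro z
  obtain ⟨U, hU, hz, g, h, g', h', hg, hh, hg', hh', hd, he⟩ := hf.common hf' z
  refine ⟨U, hU, hz, g * g', h * h', hg.mul hg', hh.mul hh', hd, ?_⟩
  intro w hw hne
  obtain ⟨e1, e2⟩ := he w hw hne
  simp only [Pi.mul_apply, e1, e2]
  exact div_mul_div_comm _ _ _ _

theorem IsMero.inv {f : Space n → ℂ} (hf : IsMero f) : IsMero f⁻¹ := by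
  intro z
  obtain ⟨U, hU, hz, g, h, hg, hh, hd, he⟩ := hf z
  obtain ⟨ε, hε, hB⟩ := Metric.isOpen_iff.1 hU z hz
  have hg' := hg.mono hB
  have hh' := hh.mono hB
  have hd' := hB.trans hd
  by_cases h0 : Metric.ball z ε ⊆ closure {w | g w ≠ 0}
  · refine ⟨Metric.ball z ε, Metric.isOpen_ball, Metric.mem_ball_self hε, h * h, g * h,
      hh'.mul hh', hg'.mul hh', dense_ne_inter Metric.isOpen_ball hh' h0 hd', ?_⟩
    intro w hw hne
    have hhw : h w ≠ 0 := right_ne_zero_of_mul hne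
    simp only [Pi.inv_apply, Pi.mul_apply, he w (hB hw) hhw, inv_div]
    exact (mul_div_mul_right _ _ hhw).symm
  · obtain ⟨x, hx, hxc⟩ := Set.not_subset.1 h0
    have hev : g =ᶠ[nhds x] 0 := by
      filter_upwards [isClosed_closure.isOpen_compl.mem_nhds hxc] with y hy
      by_contra hne
      exact hy (subset_closure hne)
    have hz0 := hg'.eqOn_zero_of_preconnected_of_eventuallyEq_zero
      (convex_ball z ε).isPreconnected hx hev
    refine ⟨Metric.ball z ε, Metric.isOpen_ball, Metric.mem_ball_self hε, 0, h,
      analyticOnNhd_const, hh', hd', ?_⟩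
    intro w hw hne
    simp [he w (hB hw) hne, hz0 hw]

theorem isMero_const (c : ℂ) : IsMero (fun _ : Space n => c) :=
  IsMero.of_analytic analyticOnNhd_const

variable (n) in
/-- The algebra of functions representing meromorphic functions. -/
def meroSubalgebra : Subalgebra ℂ (Space n → ℂ) where
  carrier := {f | IsMero f}
  mul_mem' := IsMero.mul
  add_mem' := IsMero.add
  algebraMap_mem' c := isMero_const c

variable (n) in
/-- The functions representing meromorphic functions, as a vector space. -/
def MeroFun : Submodule ℂ (Space n → ℂ) := Subalgebra.toSubmodule (meroSubalgebra n)

variable (n) in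
/-- Two representatives are identified when they agree on a dense open set; this is the space of
functions vanishing on a dense open set. -/
def genericNull : Submodule ℂ (Space n → ℂ) where
  carrier := {f | ∃ U : Set (Space n), IsOpen U ∧ Dense U ∧ ∀ z ∈ U, f z = 0}
  zero_mem' := ⟨Set.univ, isOpen_univ, dense_univ, fun _ _ => rfl⟩
  add_mem' := by
    rintro f g ⟨U, hU, hd, h⟩ ⟨V, hV, hd', h'⟩
    exact ⟨U ∩ V, hU.inter hV, hd.inter_of_isOpen_left hd' hU,
      fun z hz => by simp [h z hz.1, h' z hz.2]⟩
  smul_mem' := by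
    rintro c f ⟨U, hU, hd, h⟩
    exact ⟨U, hU, hd, fun z hz => by simp [h z hz]⟩

variable (n) in
/-- The space of meromorphic functions of the variables `m_{ij}`: functions which are locally
quotients of analytic functions, up to equality on a dense open set. -/
abbrev Mero : Type := MeroFun n ⧸ (genericNull n).comap (MeroFun n).subtype

theorem gen_mem {A : Type*} [CommRing A] [Div A] [Algebra ℂ A] {m : ℕ → ℕ → A}
    {T : ℕ → ℕ → ℂ → Module.End ℂ A} (B : Set A) (S : Submodule ℂ A)
    (hB : ∀ k j, oddUp m k j ∈ B ∧ oddDown m k j ∈ B ∧ evenUp m k j ∈ B ∧ evenDown m k j ∈ B ∧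
      evenDiag m k ∈ B)
    (hS : ∀ b ∈ B, ∀ f ∈ S, b * f ∈ S) (hT : ∀ i j a, ∀ f ∈ S, T i j a f ∈ S)
    (s : ℕ) (f : A) (hf : f ∈ S) : gen m T s f ∈ S := by
  unfold gen
  split_ifs
  · simp only [genOdd, LinearMap.sub_apply, LinearMap.neg_apply, LinearMap.sum_apply,
      Module.End.mul_apply, LinearMap.mulLeft_apply]
    exact S.sub_mem
      (S.neg_mem (S.sum_mem fun j _ => hS _ (hB _ j).1 _ (hT _ _ _ _ hf)))
      (S.sum_mem fun j _ => hS _ (hB _ j).2.1 _ (hT _ _ _ _ hf))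
  · simp only [genEven, LinearMap.add_apply, LinearMap.smul_apply, LinearMap.sum_apply,
      Module.End.mul_apply, LinearMap.mulLeft_apply]
    exact S.add_mem (S.add_mem
      (S.sum_mem fun j _ => hS _ (hB _ j).2.2.1 _ (hT _ _ _ _ hf))
      (S.sum_mem fun j _ => hS _ (hB _ j).2.2.2.1 _ (hT _ _ _ _ hf)))
      (S.smul_mem _ (hS _ (hB _ 0).2.2.2.2 _ hf))

theorem varFun_mem (i j : ℕ) : varFun n i j ∈ meroSubalgebra n := by
  unfold varFun extend
  split_ifs with h
  · exact IsMero.of_analytic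
      ((ContinuousLinearMap.proj (R := ℂ) (φ := fun _ : Entry n => ℂ) ⟨(i, j), h⟩).analyticOnNhd
        Set.univ)
  · exact zero_mem _

theorem div_mem_mero {f g : Space n → ℂ} (hf : f ∈ meroSubalgebra n)
    (hg : g ∈ meroSubalgebra n) : f / g ∈ meroSubalgebra n := by
  rw [div_eq_mul_inv]
  exact mul_mem hf (IsMero.inv hg)

theorem coeff_mem_of_div {A : Type*} [CommRing A] [Div A] [Algebra ℂ A] {m : ℕ → ℕ → A}
    (B : Subalgebra ℂ A) (hdiv : ∀ f ∈ B, ∀ g ∈ B, f / g ∈ B) (v : ∀ i j, m i j ∈ B) (k j : ℕ) :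
    oddUp m k j ∈ B ∧ oddDown m k j ∈ B ∧ evenUp m k j ∈ B ∧ evenDown m k j ∈ B ∧
    evenDiag m k ∈ B := by
  have h2 : (2 : A) ∈ B := ofNat_mem B 2
  have h1 : (1 : A) ∈ B := one_mem B
  have hh : (1 / 2 : A) ∈ B := hdiv _ h1 _ h2
  refine ⟨hdiv _ (mul_mem (prod_mem fun r _ => ?_) (prod_mem fun r _ => ?_)) _
      (mul_mem h2 (prod_mem fun r _ => ?_)),
    hdiv _ (mul_mem (prod_mem fun r _ => ?_) (prod_mem fun r _ => ?_)) _
      (mul_mem h2 (prod_mem fun r _ => ?_)),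
    hdiv _ (prod_mem fun r _ => ?_) _
      (mul_mem (mul_mem (mul_mem h2 (v _ _)) ?_) (prod_mem fun r _ => ?_)),
    hdiv _ (prod_mem fun r _ => ?_) _
      (mul_mem (mul_mem (mul_mem h2 (v _ _)) ?_) (prod_mem fun r _ => ?_)),
    hdiv _ (mul_mem (prod_mem fun r _ => v _ _) (prod_mem fun r _ => v _ _)) _
      (prod_mem fun r _ => ?_)⟩ <;>
  · repeat' first
      | exact v _ _
      | exact hh
      | exact h1
      | apply mul_mem
      | apply add_mem
      | apply sub_mem
      | apply pow_mem

theorem analyticOnNhd_translate (i j : ℕ) (a : ℂ) (S : Set (Space n)) :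
    AnalyticOnNhd ℂ (translate (n := n) i j a) S := by
  have h : translate (n := n) i j a =
      fun z => z + (fun t : Entry n => if t.1 = (i, j) then a else 0) := rfl
  rw [h]
  exact analyticOnNhd_id.add analyticOnNhd_const

/-- Translation as a homeomorphism. -/
def translateHomeo (n i j : ℕ) (a : ℂ) : Space n ≃ₜ Space n :=
  Homeomorph.addRight (fun t : Entry n => if t.1 = (i, j) then a else 0)

theorem translateHomeo_apply (i j : ℕ) (a : ℂ) (z : Space n) :
    translateHomeo n i j a z = translate i j a z := rfl

theorem shiftFun_mem_mero (i j : ℕ) (a : ℂ) (f : Space n → ℂ) (hf : f ∈ MeroFun n) :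
    shiftFun n i j a f ∈ MeroFun n := by
  intro z
  obtain ⟨U, hU, hz, g, h, hg, hh, hd, he⟩ := hf (translate i j a z)
  have hmaps : Set.MapsTo (translate i j a) (translateHomeo n i j a ⁻¹' U) U := fun w hw => hw
  refine ⟨translateHomeo n i j a ⁻¹' U, hU.preimage (translateHomeo n i j a).continuous, hz,
    g ∘ translate i j a, h ∘ translate i j a, hg.comp (analyticOnNhd_translate i j a _) hmaps,
    hh.comp (analyticOnNhd_translate i j a _) hmaps, ?_, fun w hw hne => he _ hw hne⟩
  have := (translateHomeo n i j a).preimage_closure {w | h w ≠ 0}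
  exact (Set.preimage_mono hd).trans this.le

theorem shiftFun_mem_null (i j : ℕ) (a : ℂ) (f : Space n → ℂ) (hf : f ∈ genericNull n) :
    shiftFun n i j a f ∈ genericNull n := by
  obtain ⟨U, hU, hd, h⟩ := hf
  exact ⟨translateHomeo n i j a ⁻¹' U, hU.preimage (translateHomeo n i j a).continuous,
    hd.preimage (translateHomeo n i j a).isOpenMap, fun z hz => h _ hz⟩

theorem genFun_mem_mero (s : ℕ) (f : Space n → ℂ) (hf : f ∈ MeroFun n) :
    genFun n s f ∈ MeroFun n :=
  gen_mem (meroSubalgebra n : Set (Space n → ℂ)) (MeroFun n)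
    (coeff_mem_of_div (meroSubalgebra n) (fun _ hf _ hg => div_mem_mero hf hg) varFun_mem)
    (fun _ hb _ hg => (meroSubalgebra n).mul_mem hb hg) shiftFun_mem_mero s f hf

theorem genFun_mem_null (s : ℕ) (f : Space n → ℂ) (hf : f ∈ genericNull n) :
    genFun n s f ∈ genericNull n := by
  refine gen_mem Set.univ (genericNull n) (fun _ _ => by simp) ?_ shiftFun_mem_null s f hf
  rintro b - g ⟨U, hU, hd, h⟩
  exact ⟨U, hU, hd, fun z hz => by simp [h z hz]⟩

end Closure

/-- The operator `I_{s+1,s}` on meromorphic functions. -/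
def genMero (n s : ℕ) : Module.End ℂ (Mero n) :=
  Submodule.mapQ _ _ ((genFun n s).restrict fun f hf => genFun_mem_mero s f hf)
    (fun f hf => genFun_mem_null s f.1 hf)

end GelfandTsetlinSO

end

noncomputable section

namespace GelfandTsetlinSO

/-! ### Serre relations for difference operators with signed indices -/

section Abstract

variable {Λ K : Type*} [AddCommGroup Λ] [Field K]

/-- The difference operator `∑ a_ε e^{u_ε}` on functions on an abelian group. -/
def diffOp (E : Finset ℤ) (u : ℤ → Λ) (a : ℤ → Λ → K) : Module.End K (Λ → K) where
  toFun Φ l := ∑ ε ∈ E, a ε l * Φ (l + u ε)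
  map_add' _ _ := by
    funext l
    simp [mul_add, Finset.sum_add_distrib]
  map_smul' c _ := by
    funext l
    simp [Finset.mul_sum, mul_left_comm]

theorem diffOp_apply (E : Finset ℤ) (u : ℤ → Λ) (a : ℤ → Λ → K) (Φ : Λ → K) (l : Λ) :
    diffOp E u a Φ l = ∑ ε ∈ E, a ε l * Φ (l + u ε) := rfl

/-- In a double sum over a symmetric index set, only the pairs `(ε, -ε)` contribute if the
other terms are antisymmetric. -/
theorem sum_sum_eq_sum_neg [CharZero K] {E : Finset ℤ} (hE : ∀ ε ∈ E, -ε ∈ E) (W : ℤ → ℤ → K)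
    (hW : ∀ ε ∈ E, ∀ δ ∈ E, δ ≠ -ε → W ε δ + W δ ε = 0) :
    ∑ ε ∈ E, ∑ δ ∈ E, W ε δ = ∑ ε ∈ E, W ε (-ε) := by
  have h0 : ∑ ε ∈ E, ∑ δ ∈ E, (if δ = -ε then 0 else W ε δ) = 0 := by
    have h1 : ∑ ε ∈ E, ∑ δ ∈ E, (if δ = -ε then 0 else W ε δ) =
        - ∑ ε ∈ E, ∑ δ ∈ E, (if δ = -ε then 0 else W ε δ) := by
      conv_lhs => rw [Finset.sum_comm]
      rw [← Finset.sum_neg_distrib]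
      refine Finset.sum_congr rfl fun δ hδ => ?_
      rw [← Finset.sum_neg_distrib]
      refine Finset.sum_congr rfl fun ε hε => ?_
      by_cases h : ε = -δ
      · simp [h]
      · have h' : δ ≠ -ε := fun h'' => h (by rw [h'', neg_neg])
        rw [if_neg h, if_neg h']
        exact eq_neg_of_add_eq_zero_left (hW ε hε δ hδ h')
    exact self_eq_neg.1 h1
  have h2 : ∑ ε ∈ E, ∑ δ ∈ E, W ε δ =
      ∑ ε ∈ E, ∑ δ ∈ E, ((if δ = -ε then W ε δ else 0) + (if δ = -ε then 0 else W ε δ)) := by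
    refine Finset.sum_congr rfl fun ε _ => Finset.sum_congr rfl fun δ _ => ?_
    split_ifs <;> simp
  rw [h2]
  simp only [Finset.sum_add_distrib]
  rw [h0, add_zero]
  refine Finset.sum_congr rfl fun ε hε => ?_
  rw [Finset.sum_ite_eq' E (-ε), if_pos (hE ε hε)]

theorem diffOp_lie_lie [CharZero K] {E F : Finset ℤ} {u v : ℤ → Λ} {a b X Y : ℤ → Λ → K}
    (hE : ∀ ε ∈ E, -ε ∈ E) (hu : ∀ ε, u (-ε) = -u ε)
    (hYu : ∀ ε ∈ E, ∀ β ∈ F, ∀ l, Y β (l + u ε) = Y β l)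
    (hX : ∀ ε ∈ E, ∀ δ ∈ E, δ ≠ ε → δ ≠ -ε → ∀ l, X δ (l + u ε) = X δ l)
    (hXself : ∀ ε ∈ E, ε ≠ 0 → ∀ l, X ε (l + u ε) = X ε l + 1)
    (hXneg : ∀ ε ∈ E, ∀ l, X (-ε) (l + u ε) = -X ε l - 1)
    (hg : ∀ ε ∈ E, ∀ β ∈ F, ∀ l, X ε l - Y β l + 1 / 2 ≠ 0)
    (hmix : ∀ ε ∈ E, ∀ β ∈ F, ∀ l, a ε (l + v β) * b β l * (X ε l - Y β l + 1 / 2) =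
      a ε l * b β (l + u ε) * (X ε l - Y β l - 1 / 2))
    (hanti : ∀ ε ∈ E, ∀ δ ∈ E, δ ≠ ε → δ ≠ -ε → ∀ l,
      a ε l * a δ (l + u ε) * (X ε l - X δ l + 1) +
        a δ l * a ε (l + u δ) * (X δ l - X ε l + 1) = 0)
    (hsum : ∀ β ∈ F, ∀ l, ∑ ε ∈ E, a ε l * a (-ε) (l + u ε) *
      (X ε l - X (-ε) (l + u ε) + 1) / ((X ε l + 1 / 2) ^ 2 - Y β l ^ 2) = 1) :
    ⁅diffOp E u a, ⁅diffOp F v b, diffOp E u a⁆⁆ = diffOp F v b := by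
  refine LinearMap.ext fun Φ => funext fun l => ?_
  set V : ℤ → ℤ → ℤ → K := fun β ε δ =>
    2 * (a ε l * b β (l + u ε) * a δ (l + u ε + v β))
      - a ε l * a δ (l + u ε) * b β (l + u ε + u δ)
      - b β l * a ε (l + v β) * a δ (l + u ε + v β) with hV
  have key : ∀ β ∈ F, ∀ ε ∈ E, ∀ δ ∈ E, V β ε δ =
      -(a ε l * a δ (l + u ε) * (X ε l - X δ (l + u ε) + 1) * b β (l + u ε + u δ) /
        ((X ε l - Y β l + 1 / 2) * (X δ (l + u ε) - Y β l + 1 / 2))) := by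
    intro β hβ ε hε δ hδ
    have h1 := hmix ε hε β hβ l
    have h2 := hmix δ hδ β hβ (l + u ε)
    have g1 := hg ε hε β hβ l
    have g2 := hg δ hδ β hβ (l + u ε)
    rw [hYu ε hε β hβ] at h2 g2
    rw [← neg_div, eq_div_iff (mul_ne_zero g1 g2), hV]
    generalize hG : X ε l - Y β l + 1 / 2 = g at *
    generalize hG' : X δ (l + u ε) - Y β l + 1 / 2 = g' at *
    have e1 : X ε l - Y β l - 1 / 2 = g - 1 := by rw [← hG]; ring
    have e2 : X δ (l + u ε) - Y β l - 1 / 2 = g' - 1 := by rw [← hG']; ring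
    have e3 : X ε l - X δ (l + u ε) + 1 = g - g' + 1 := by rw [← hG, ← hG']; ring
    rw [e1] at h1
    rw [e2] at h2
    rw [e3]
    linear_combination (2 * a ε l * g - a ε l * (g - 1)) * h2 - a δ (l + u ε + v β) * g' * h1
  have expand : ⁅diffOp E u a, ⁅diffOp F v b, diffOp E u a⁆⁆ Φ l =
      ∑ β ∈ F, ∑ ε ∈ E, ∑ δ ∈ E, V β ε δ * Φ (l + u ε + u δ + v β) := by
    have t1 : diffOp E u a (diffOp F v b (diffOp E u a Φ)) l = ∑ β ∈ F, ∑ ε ∈ E, ∑ δ ∈ E,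
        a ε l * b β (l + u ε) * a δ (l + u ε + v β) * Φ (l + u ε + u δ + v β) := by
      rw [Finset.sum_comm]
      simp only [diffOp_apply, Finset.mul_sum]
      refine Finset.sum_congr rfl fun ε _ => Finset.sum_congr rfl fun β _ =>
        Finset.sum_congr rfl fun δ _ => ?_
      rw [add_right_comm _ (v β) (u δ)]
      ring
    have t2 : diffOp E u a (diffOp E u a (diffOp F v b Φ)) l = ∑ β ∈ F, ∑ ε ∈ E, ∑ δ ∈ E,
        a ε l * a δ (l + u ε) * b β (l + u ε + u δ) * Φ (l + u ε + u δ + v β) := by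
      rw [Finset.sum_comm]
      simp only [diffOp_apply, Finset.mul_sum]
      refine Finset.sum_congr rfl fun ε _ => ?_
      rw [Finset.sum_comm]
      refine Finset.sum_congr rfl fun β _ => Finset.sum_congr rfl fun δ _ => ?_
      ring
    have t3 : diffOp F v b (diffOp E u a (diffOp E u a Φ)) l = ∑ β ∈ F, ∑ ε ∈ E, ∑ δ ∈ E,
        b β l * a ε (l + v β) * a δ (l + u ε + v β) * Φ (l + u ε + u δ + v β) := by
      simp only [diffOp_apply, Finset.mul_sum]
      refine Finset.sum_congr rfl fun β _ => Finset.sum_congr rfl fun ε _ =>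
        Finset.sum_congr rfl fun δ _ => ?_
      rw [add_right_comm _ (v β) (u ε), add_right_comm _ (v β) (u δ)]
      ring
    simp only [Ring.lie_def, mul_sub, sub_mul, LinearMap.sub_apply, Module.End.mul_apply,
      Pi.sub_apply, t1, t2, t3, ← Finset.sum_sub_distrib]
    refine Finset.sum_congr rfl fun β _ => Finset.sum_congr rfl fun ε _ =>
        Finset.sum_congr rfl fun δ _ => ?_
    rw [hV]
    ring
  rw [expand, diffOp_apply]
  refine Finset.sum_congr rfl fun β hβ => ?_
  rw [sum_sum_eq_sum_neg hE]
  · rw [← mul_one (b β l), ← hsum β hβ l, Finset.mul_sum, Finset.sum_mul]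
    refine Finset.sum_congr rfl fun ε hε => ?_
    have g1 := hg ε hε β hβ l
    have g2 := hg (-ε) (hE ε hε) β hβ (l + u ε)
    rw [hYu ε hε β hβ] at g2
    have hu0 : l + u ε + u (-ε) = l := by rw [hu, add_neg_cancel_right]
    rw [key β hβ ε hε (-ε) (hE ε hε), hu0]
    have e : (X ε l + 1 / 2) ^ 2 - Y β l ^ 2 =
        -((X ε l - Y β l + 1 / 2) * (X (-ε) (l + u ε) - Y β l + 1 / 2)) := by
      rw [hXneg ε hε]; ring
    rw [e, div_neg]
    ring
  · intro ε hε δ hδ hne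
    rw [add_right_comm l (u δ) (u ε), ← add_mul]
    refine mul_eq_zero_of_left ?_ _
    rw [key β hβ ε hε δ hδ, key β hβ δ hδ ε hε]
    by_cases h : δ = ε
    · subst h
      have h0 : δ ≠ 0 := fun h0 => hne (by simp [h0])
      simp [hXself δ hδ h0]
    · have hne' : ε ≠ -δ := fun h'' => hne (by rw [h'', neg_neg])
      rw [hX ε hε δ hδ h hne, hX δ hδ ε hε (Ne.symm h) hne', add_right_comm l (u δ) (u ε),
        mul_comm (X δ l - Y β l + 1 / 2), ← neg_add, ← add_div, ← add_mul,
        hanti ε hε δ hδ h hne]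
      simp

/-- Difference operators commute if the shifts in either do not affect the coefficients of
the other. -/
theorem diffOp_lie_eq_zero {E F : Finset ℤ} {u v : ℤ → Λ} {a b : ℤ → Λ → K}
    (ha : ∀ ε ∈ E, ∀ β ∈ F, ∀ l, a ε (l + v β) = a ε l)
    (hb : ∀ ε ∈ E, ∀ β ∈ F, ∀ l, b β (l + u ε) = b β l) :
    ⁅diffOp E u a, diffOp F v b⁆ = 0 := by
  refine LinearMap.ext fun Φ => funext fun l => ?_
  rw [Ring.lie_def, LinearMap.sub_apply, Module.End.mul_apply, Module.End.mul_apply,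
    Pi.sub_apply, LinearMap.zero_apply, Pi.zero_apply, sub_eq_zero]
  simp only [diffOp_apply, Finset.mul_sum]
  rw [Finset.sum_comm]
  refine Finset.sum_congr rfl fun β hβ => Finset.sum_congr rfl fun ε hε => ?_
  rw [ha ε hε β hβ, hb ε hε β hβ, add_right_comm]
  ring

end Abstract

/-! ### Signed index sets and interpolation -/

@[to_additive]
theorem prod_signed {M : Type*} [CommMonoid M] (k : ℕ) (f : ℤ → M) :
    ∏ ε ∈ Finset.Icc (-k : ℤ) k, f ε =
      (∏ j ∈ Finset.Icc 1 k, f j) * (∏ j ∈ Finset.Icc 1 k, f (-j)) * f 0 := by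
  induction k with
  | zero => simp
  | succ k ih =>
    have h : Finset.Icc (-(k + 1 : ℕ) : ℤ) (k + 1 : ℕ) =
        insert ((k + 1 : ℕ) : ℤ) (insert (-(k + 1 : ℕ) : ℤ) (Finset.Icc (-k : ℤ) k)) := by
      ext x
      simp only [Finset.mem_Icc, Finset.mem_insert]
      omega
    rw [h, Finset.prod_insert, Finset.prod_insert, ih, Finset.prod_Icc_succ_top (by omega),
      Finset.prod_Icc_succ_top (by omega)]
    · ac_rfl
    · simp only [Finset.mem_Icc]; omega
    · simp only [Finset.mem_Icc, Finset.mem_insert]; omega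

/-- Lagrange interpolation: the divided difference of a monic polynomial, divided by a linear
factor. -/
theorem sum_eval_div_eq_one {K ι : Type*} [Field K] [DecidableEq ι] (s : Finset ι) (z : ι → K)
    (hz : Set.InjOn z s) (Q : Polynomial K) (hQ : Q.Monic) (hdeg : Q.natDegree = s.card) (c : K)
    (hc : Q.eval c = 0) (hzc : ∀ i ∈ s, z i - c ≠ 0) :
    ∑ i ∈ s, Q.eval (z i) / (∏ j ∈ s.erase i, (z i - z j)) / (z i - c) = 1 := by
  obtain ⟨P, rfl⟩ := Polynomial.dvd_iff_isRoot.2 hc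
  have hP : P.Monic := Polynomial.Monic.of_mul_monic_left (Polynomial.monic_X_sub_C c) hQ
  rw [(Polynomial.monic_X_sub_C c).natDegree_mul hP, Polynomial.natDegree_X_sub_C] at hdeg
  have hd : (s.card : WithBot ℕ) = P.degree + 1 := by
    rw [Polynomial.degree_eq_natDegree hP.ne_zero, ← hdeg]
    push_cast
    ring
  rw [← hP.leadingCoeff, Lagrange.leadingCoeff_eq_sum hz hd]
  refine Finset.sum_congr rfl fun i hi => ?_
  rw [Polynomial.eval_mul, Polynomial.eval_sub, Polynomial.eval_X, Polynomial.eval_C, div_div,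
    mul_comm (∏ j ∈ s.erase i, (z i - z j)), mul_div_mul_left _ _ (hzc i hi)]


/-! ### The coefficients as functions of three adjacent rows -/

section Rows

variable {K : Type*} [Field K]

/-- The entry of a row with signed index `ε`: `x_{-j} = -x_j` and `x_0 = -1/2`. -/
def signedEntry (x : ℕ → K) (ε : ℤ) : K :=
  if ε = 0 then -1 / 2 else (ε.sign : K) * x ε.natAbs

/-- The row `x` shifted by the unit vector with signed index `ε`. -/
def bump (ε : ℤ) (x : ℕ → K) (j : ℕ) : K := x j + if j = ε.natAbs then (ε.sign : K) else 0

/-- A coefficient with the shape common to all the generators. -/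
def signedCoef (k : ℕ) (N : ℤ → K → K) (D : ℤ → K → K → K) (c : K) (x : ℕ → K) (ε : ℤ) : K :=
  if ε = 0 then c else
    N ε.sign (x ε.natAbs) / ∏ r ∈ (Finset.Icc 1 k).erase ε.natAbs, D ε.sign (x ε.natAbs) (x r)

theorem signedEntry_zero (x : ℕ → K) : signedEntry x 0 = -1 / 2 := if_pos rfl

theorem bump_zero (x : ℕ → K) : bump 0 x = x := by
  funext j
  simp [bump]

theorem bump_of_ne {ε : ℤ} {j : ℕ} (h : j ≠ ε.natAbs) (x : ℕ → K) : bump ε x j = x j := by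
  simp [bump, h]

theorem bump_natAbs (ε : ℤ) (x : ℕ → K) : bump ε x ε.natAbs = x ε.natAbs + ε.sign := by
  simp [bump]

theorem signedEntry_of_ne {ε : ℤ} (h : ε ≠ 0) (x : ℕ → K) :
    signedEntry x ε = (ε.sign : K) * x ε.natAbs := if_neg h

theorem signedCoef_zero (k : ℕ) (N : ℤ → K → K) (D : ℤ → K → K → K) (c : K) (x : ℕ → K) :
    signedCoef k N D c x 0 = c := if_pos rfl

theorem signedCoef_of_ne {ε : ℤ} (h : ε ≠ 0) (k : ℕ) (N : ℤ → K → K) (D : ℤ → K → K → K) (c : K)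
    (x : ℕ → K) : signedCoef k N D c x ε = N ε.sign (x ε.natAbs) /
      ∏ r ∈ (Finset.Icc 1 k).erase ε.natAbs, D ε.sign (x ε.natAbs) (x r) := if_neg h

theorem sign_cases {ε : ℤ} (h : ε ≠ 0) : ε.sign = 1 ∨ ε.sign = -1 := by
  rcases lt_or_gt_of_ne h with h | h
  · exact Or.inr (Int.sign_eq_neg_one_of_neg h)
  · exact Or.inl (Int.sign_eq_one_of_pos h)

theorem natAbs_mem {k : ℕ} {ε : ℤ} (h : ε ∈ Finset.Icc (-k : ℤ) k) (h0 : ε ≠ 0) :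
    ε.natAbs ∈ Finset.Icc 1 k := by
  rw [Finset.mem_Icc] at *
  omega

theorem neg_mem_signed {k : ℕ} {ε : ℤ} (h : ε ∈ Finset.Icc (-k : ℤ) k) :
    -ε ∈ Finset.Icc (-k : ℤ) k := by
  rw [Finset.mem_Icc] at *
  omega

theorem signedEntry_neg_bump [CharZero K] (x : ℕ → K) (ε : ℤ) :
    signedEntry (bump ε x) (-ε) = -signedEntry x ε - 1 := by
  rcases eq_or_ne ε 0 with rfl | h
  · rw [bump_zero, neg_zero, signedEntry_zero]; norm_num
  · rw [signedEntry_of_ne (neg_ne_zero.2 h), signedEntry_of_ne h, Int.natAbs_neg, bump_natAbs,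
      Int.sign_neg]
    rcases sign_cases h with h | h <;> rw [h] <;> push_cast <;> ring

theorem signedEntry_bump_self (x : ℕ → K) {ε : ℤ} (h : ε ≠ 0) :
    signedEntry (bump ε x) ε = signedEntry x ε + 1 := by
  rw [signedEntry_of_ne h, signedEntry_of_ne h, bump_natAbs]
  rcases sign_cases h with h | h <;> rw [h] <;> push_cast <;> ring

theorem signedEntry_bump_of_ne (x : ℕ → K) {ε δ : ℤ} (h : δ ≠ ε) (h' : δ ≠ -ε) :
    signedEntry (bump ε x) δ = signedEntry x δ := by
  unfold signedEntry
  split_ifs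
  · rfl
  · rw [bump_of_ne (by omega)]

/-- Numerators in the coefficients of `I_{2k+1,2k}`. -/
def oddNum (k : ℕ) (w y : ℕ → K) (σ : ℤ) (p : K) : K :=
  if σ = 1 then
    -((∏ r ∈ Finset.Icc 1 (k - 1), (w r + p + 1 / 2)) * ∏ r ∈ Finset.Icc 1 k, (p - y r + 1 / 2)) / 2
  else
    -((∏ r ∈ Finset.Icc 1 (k - 1), (p - w r - 1 / 2)) * ∏ r ∈ Finset.Icc 1 k, (y r + p - 1 / 2)) / 2

/-- Factors of the denominators in the coefficients of `I_{2k+1,2k}`. -/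
def oddDen (σ : ℤ) (p q : K) : K := (p - q) * (p + q + σ)

/-- Numerators in the coefficients of `I_{2k+2,2k+1}`. -/
def evenNum (k : ℕ) (w y : ℕ → K) (σ : ℤ) (p : K) : K :=
  if σ = 1 then
    (∏ r ∈ Finset.Icc 1 (k + 1), ((p + 1 / 2) ^ 2 - y r ^ 2)) / (2 * p * (p + 1 / 2))
  else
    (∏ r ∈ Finset.Icc 1 k, ((p - 1 / 2) ^ 2 - w r ^ 2)) / (2 * p * (p - 1 / 2))

/-- Factors of the denominators in the coefficients of `I_{2k+2,2k+1}`. -/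
def evenDen (_ : ℤ) (p q : K) : K := p ^ 2 - q ^ 2

/-- The coefficients of `I_{2k+1,2k}`. -/
def oddCoef (k : ℕ) (w x y : ℕ → K) : ℤ → K := signedCoef k (oddNum k w y) oddDen 0 x

/-- The coefficients of `I_{2k+2,2k+1}`. -/
def evenCoef [Algebra ℂ K] (k : ℕ) (w x y : ℕ → K) : ℤ → K :=
  signedCoef k (evenNum k w y) evenDen (algebraMap ℂ K Complex.I *
    (((∏ r ∈ Finset.Icc 1 k, w r) * ∏ r ∈ Finset.Icc 1 (k + 1), y r) /
      ∏ r ∈ Finset.Icc 1 k, ((x r + 1 / 2) * (x r - 1 / 2)))) x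

theorem exists_prod_eq {S : Finset ℕ} {i : ℕ} (hi : i ∈ S) (f g : ℕ → K)
    (h : ∀ r, r ≠ i → f r = g r) :
    ∃ P, ∏ r ∈ S, f r = f i * P ∧ ∏ r ∈ S, g r = g i * P := by
  refine ⟨∏ r ∈ S.erase i, g r, ?_, (Finset.mul_prod_erase S g hi).symm⟩
  rw [← Finset.mul_prod_erase S f hi]
  congr 1
  exact Finset.prod_congr rfl fun r hr => h r (Finset.ne_of_mem_erase hr)

theorem oddCoef_mul_evenCoef [CharZero K] [Algebra ℂ K] {k : ℕ} (w x y t : ℕ → K) {ε β : ℤ}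
    (hε : ε ∈ Finset.Icc (-k : ℤ) k) (hβ : β ∈ Finset.Icc (-k : ℤ) k) :
    oddCoef k w x (bump β y) ε * evenCoef k x y t β *
        (signedEntry x ε - signedEntry y β + 1 / 2) =
      oddCoef k w x y ε * evenCoef k (bump ε x) y t β *
        (signedEntry x ε - signedEntry y β - 1 / 2) := by
  unfold oddCoef evenCoef
  rcases eq_or_ne ε 0 with rfl | h
  · simp [signedCoef_zero]
  have hj := natAbs_mem hε h
  rcases eq_or_ne β 0 with rfl | h'
  · rw [bump_zero, signedCoef_zero, signedCoef_zero, signedCoef_of_ne h, signedEntry_zero,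
      signedEntry_of_ne h]
    obtain ⟨P, h1, h2⟩ := exists_prod_eq hj (bump ε x) x fun r hr => bump_of_ne hr x
    rw [h1, h2, bump_natAbs]
    rcases sign_cases h with h | h <;> rw [h] <;> push_cast <;> ring
  have hi := natAbs_mem hβ h'
  rw [signedCoef_of_ne h, signedCoef_of_ne h, signedCoef_of_ne h', signedCoef_of_ne h',
    signedEntry_of_ne h, signedEntry_of_ne h']
  set j := ε.natAbs
  set i := β.natAbs
  obtain ⟨P, h1, h2⟩ := exists_prod_eq hi (fun r => x j - bump β y r + 1 / 2)
    (fun r => x j - y r + 1 / 2) fun r hr => by rw [bump_of_ne hr]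
  obtain ⟨P', h1', h2'⟩ := exists_prod_eq hi (fun r => bump β y r + x j - 1 / 2)
    (fun r => y r + x j - 1 / 2) fun r hr => by rw [bump_of_ne hr]
  obtain ⟨R, h3, h4⟩ := exists_prod_eq hj (fun r => (y i - 1 / 2) ^ 2 - bump ε x r ^ 2)
    (fun r => (y i - 1 / 2) ^ 2 - x r ^ 2) fun r hr => by rw [bump_of_ne hr]
  simp only [bump_natAbs, i, j] at h1 h1' h3
  rcases sign_cases h with e | e <;> rcases sign_cases h' with e' | e' <;> rw [e'] at h1 h1' <;>
    rw [e] at h3 <;> rw [e, e'] <;>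
    simp only [oddNum, evenNum, if_true, show ¬ (-1 : ℤ) = 1 by decide, if_false, h1, h1', h2, h2',
      h3, h4, i, j] <;>
    push_cast <;> ring

theorem evenCoef_mul_oddCoef [CharZero K] [Algebra ℂ K] {k : ℕ} (w x y t : ℕ → K) {ε β : ℤ}
    (hε : ε ∈ Finset.Icc (-k : ℤ) k) (hβ : β ∈ Finset.Icc (-(k + 1 : ℕ) : ℤ) (k + 1 : ℕ)) :
    evenCoef k w x (bump β y) ε * oddCoef (k + 1) x y t β *
        (signedEntry x ε - signedEntry y β + 1 / 2) =
      evenCoef k w x y ε * oddCoef (k + 1) (bump ε x) y t β *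
        (signedEntry x ε - signedEntry y β - 1 / 2) := by
  unfold oddCoef evenCoef
  rcases eq_or_ne β 0 with rfl | h'
  · simp [signedCoef_zero]
  have hi := natAbs_mem hβ h'
  rcases eq_or_ne ε 0 with rfl | h
  · rw [bump_zero, signedCoef_zero, signedCoef_zero, signedCoef_of_ne h', signedEntry_zero,
      signedEntry_of_ne h']
    obtain ⟨P, h1, h2⟩ := exists_prod_eq hi (bump β y) y fun r hr => bump_of_ne hr y
    rw [h1, h2, bump_natAbs]
    rcases sign_cases h' with h | h <;> rw [h] <;> push_cast <;> ring
  have hj := natAbs_mem hε h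
  rw [signedCoef_of_ne h, signedCoef_of_ne h, signedCoef_of_ne h', signedCoef_of_ne h',
    signedEntry_of_ne h, signedEntry_of_ne h']
  set j := ε.natAbs
  set i := β.natAbs
  obtain ⟨P, h1, h2⟩ := exists_prod_eq hj (fun r => bump ε x r + y i + 1 / 2)
    (fun r => x r + y i + 1 / 2) fun r hr => by rw [bump_of_ne hr]
  obtain ⟨P', h1', h2'⟩ := exists_prod_eq hj (fun r => y i - bump ε x r - 1 / 2)
    (fun r => y i - x r - 1 / 2) fun r hr => by rw [bump_of_ne hr]
  obtain ⟨R, h3, h4⟩ := exists_prod_eq hi (fun r => (x j + 1 / 2) ^ 2 - bump β y r ^ 2)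
    (fun r => (x j + 1 / 2) ^ 2 - y r ^ 2) fun r hr => by rw [bump_of_ne hr]
  simp only [bump_natAbs, i, j] at h1 h1' h3
  rcases sign_cases h with e | e <;> rcases sign_cases h' with e' | e' <;> rw [e] at h1 h1' <;>
    rw [e'] at h3 <;> rw [e, e'] <;>
    simp only [oddNum, evenNum, if_true, show ¬ (-1 : ℤ) = 1 by decide, if_false, h1, h1', h2, h2',
      h3, h4, i, j, Nat.add_sub_cancel] <;>
    push_cast <;> ring

/-- No half integers among the entries of a row, their sums and their differences. -/
structure GenericRow (k : ℕ) (x : ℕ → K) : Prop where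
  entry : ∀ i ∈ Finset.Icc 1 k, ∀ c : ℤ, x i ≠ c / 2
  add : ∀ i ∈ Finset.Icc 1 k, ∀ j ∈ Finset.Icc 1 k, i ≠ j → ∀ c : ℤ, x i + x j ≠ c / 2
  sub : ∀ i ∈ Finset.Icc 1 k, ∀ j ∈ Finset.Icc 1 k, i ≠ j → ∀ c : ℤ, x i - x j ≠ c / 2

theorem signedCoef_antisymm {k : ℕ} (N : ℤ → K → K) (D : ℤ → K → K → K) (c c' d d' : K)
    (x : ℕ → K) {ε δ : ℤ} (hε : ε ∈ Finset.Icc (-k : ℤ) k) (hδ : δ ∈ Finset.Icc (-k : ℤ) k)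
    (hε0 : ε ≠ 0) (hδ0 : δ ≠ 0) (h : δ ≠ ε) (h' : δ ≠ -ε)
    (hD : (ε.sign * x ε.natAbs - δ.sign * x δ.natAbs + 1) /
          (D ε.sign (x ε.natAbs) (x δ.natAbs) * D δ.sign (x δ.natAbs) (x ε.natAbs + ε.sign)) +
        (δ.sign * x δ.natAbs - ε.sign * x ε.natAbs + 1) /
          (D δ.sign (x δ.natAbs) (x ε.natAbs) * D ε.sign (x ε.natAbs) (x δ.natAbs + δ.sign)) = 0) :
    signedCoef k N D c x ε * signedCoef k N D c' (bump ε x) δ *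
        (signedEntry x ε - signedEntry x δ + 1) +
      signedCoef k N D d x δ * signedCoef k N D d' (bump δ x) ε *
        (signedEntry x δ - signedEntry x ε + 1) = 0 := by
  have hne : ε.natAbs ≠ δ.natAbs := by omega
  have hi := natAbs_mem hδ hδ0
  have hj := natAbs_mem hε hε0
  rw [signedCoef_of_ne hε0, signedCoef_of_ne hδ0, signedCoef_of_ne hε0, signedCoef_of_ne hδ0,
    signedEntry_of_ne hε0, signedEntry_of_ne hδ0, bump_of_ne hne.symm, bump_of_ne hne]
  obtain ⟨P, h1, h2⟩ := exists_prod_eq (Finset.mem_erase.2 ⟨hne, hj⟩)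
    (fun r => D δ.sign (x δ.natAbs) (bump ε x r)) (fun r => D δ.sign (x δ.natAbs) (x r))
    fun r hr => by rw [bump_of_ne hr]
  obtain ⟨R, h3, h4⟩ := exists_prod_eq (Finset.mem_erase.2 ⟨hne.symm, hi⟩)
    (fun r => D ε.sign (x ε.natAbs) (bump δ x r)) (fun r => D ε.sign (x ε.natAbs) (x r))
    fun r hr => by rw [bump_of_ne hr]
  rw [bump_natAbs] at h1 h3
  rw [h1, h2, h3, h4]
  linear_combination (N ε.sign (x ε.natAbs) * N δ.sign (x δ.natAbs) / (P * R)) * hD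

theorem oddCoef_antisymm [CharZero K] {k : ℕ} (w y : ℕ → K) {x : ℕ → K} (hx : GenericRow k x)
    {ε δ : ℤ} (hε : ε ∈ (Finset.Icc (-k : ℤ) k).erase 0)
    (hδ : δ ∈ (Finset.Icc (-k : ℤ) k).erase 0) (h : δ ≠ ε) (h' : δ ≠ -ε) :
    oddCoef k w x y ε * oddCoef k w (bump ε x) y δ * (signedEntry x ε - signedEntry x δ + 1) +
      oddCoef k w x y δ * oddCoef k w (bump δ x) y ε *
        (signedEntry x δ - signedEntry x ε + 1) = 0 := by
  rw [Finset.mem_erase] at hε hδ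
  have hne : ε.natAbs ≠ δ.natAbs := by omega
  have hadd := hx.add _ (natAbs_mem hε.2 hε.1) _ (natAbs_mem hδ.2 hδ.1) hne
  have hsub := hx.sub _ (natAbs_mem hε.2 hε.1) _ (natAbs_mem hδ.2 hδ.1) hne
  refine signedCoef_antisymm _ _ _ _ _ _ x hε.2 hδ.2 hε.1 hδ.1 h h' ?_
  generalize x ε.natAbs = p at *
  generalize x δ.natAbs = q at *
  have a0 : p + q ≠ 0 := fun e => hadd 0 (by rw [e]; simp)
  have a1 : p + q + 1 ≠ 0 := fun e => hadd (-2) (by push_cast; linear_combination e)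
  have a2 : p + q - 1 ≠ 0 := fun e => hadd 2 (by push_cast; linear_combination e)
  have a3 : p + q + 2 ≠ 0 := fun e => hadd (-4) (by push_cast; linear_combination e)
  have a4 : p + q - 2 ≠ 0 := fun e => hadd 4 (by push_cast; linear_combination e)
  have s0 : p - q ≠ 0 := fun e => hsub 0 (by rw [e]; simp)
  have s1 : p - q + 1 ≠ 0 := fun e => hsub (-2) (by push_cast; linear_combination e)
  have s2 : p - q - 1 ≠ 0 := fun e => hsub 2 (by push_cast; linear_combination e)
  unfold oddDen
  have t0 : q - p = -(p - q) := by ring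
  rcases sign_cases hε.1 with e | e <;> rcases sign_cases hδ.1 with e' | e' <;> rw [e, e'] <;>
    push_cast
  · rw [show q - (p + 1) = -(p - q + 1) by ring, show q + (p + 1) + 1 = p + q + 2 by ring, t0,
      show q + p + 1 = p + q + 1 by ring, show p - (q + 1) = p - q - 1 by ring,
      show p + (q + 1) + 1 = p + q + 2 by ring]
    field_simp
    ring
  · rw [show q - (p + 1) = -(p - q + 1) by ring, show q + (p + 1) + -1 = p + q by ring, t0,
      show q + p + -1 = p + q - 1 by ring, show p - (q + -1) = p - q + 1 by ring,
      show p + (q + -1) + 1 = p + q by ring]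
    field_simp
    ring
  · rw [show q - (p + -1) = -(p - q - 1) by ring, show q + (p + -1) + 1 = p + q by ring, t0,
      show q + p + 1 = p + q + 1 by ring, show p - (q + 1) = p - q - 1 by ring,
      show p + (q + 1) + -1 = p + q by ring, show p + q + -1 = p + q - 1 by ring]
    field_simp
    ring
  · rw [show q - (p + -1) = -(p - q - 1) by ring, show q + (p + -1) + -1 = p + q - 2 by ring, t0,
      show q + p + -1 = p + q - 1 by ring, show p - (q + -1) = p - q + 1 by ring,
      show p + (q + -1) + -1 = p + q - 2 by ring, show p + q + -1 = p + q - 1 by ring]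
    field_simp
    ring

theorem evenCoef_antisymm_zero [CharZero K] [Algebra ℂ K] {k : ℕ} (w y : ℕ → K) {x : ℕ → K}
    (hx : GenericRow k x) {δ : ℤ} (hδ : δ ∈ Finset.Icc (-k : ℤ) k) (hδ0 : δ ≠ 0) :
    evenCoef k w x y 0 * evenCoef k w x y δ * (-1 / 2 - signedEntry x δ + 1) +
      evenCoef k w x y δ * evenCoef k w (bump δ x) y 0 *
        (signedEntry x δ - -1 / 2 + 1) = 0 := by
  have hj := natAbs_mem hδ hδ0
  have hp := hx.entry _ hj
  unfold evenCoef
  rw [signedCoef_zero, signedCoef_zero, signedEntry_of_ne hδ0]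
  generalize signedCoef k _ _ _ x δ = B
  obtain ⟨P, h1, h2⟩ := exists_prod_eq hj
    (fun r => (bump δ x r + 1 / 2) * (bump δ x r - 1 / 2))
    (fun r => (x r + 1 / 2) * (x r - 1 / 2)) fun r hr => by rw [bump_of_ne hr]
  rw [h1, h2, bump_natAbs]
  generalize x δ.natAbs = p at *
  have a1 : p + 1 / 2 ≠ 0 := fun e => hp (-1) (by push_cast; linear_combination e)
  have a2 : p - 1 / 2 ≠ 0 := fun e => hp 1 (by push_cast; linear_combination e)
  have a3 : p + 3 / 2 ≠ 0 := fun e => hp (-3) (by push_cast; linear_combination e)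
  have a4 : p - 3 / 2 ≠ 0 := fun e => hp 3 (by push_cast; linear_combination e)
  rcases sign_cases hδ0 with e | e <;> rw [e] <;> push_cast
  · rw [show p + 1 + 1 / 2 = p + 3 / 2 by ring, show p + 1 - 1 / 2 = p + 1 / 2 by ring]
    have key : (-1 / 2 - 1 * p + 1) / ((p + 1 / 2) * (p - 1 / 2)) +
        (1 * p - -1 / 2 + 1) / ((p + 3 / 2) * (p + 1 / 2)) = 0 := by
      rw [show -1 / 2 - 1 * p + 1 = -(p - 1 / 2) by ring,
        show 1 * p - -1 / 2 + 1 = p + 3 / 2 by ring]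
      generalize p + 1 / 2 = a at *
      generalize p - 1 / 2 = b at *
      generalize p + 3 / 2 = c at *
      field_simp
      ring
    generalize (p + 1 / 2) * (p - 1 / 2) = d at *
    generalize (p + 3 / 2) * (p + 1 / 2) = d' at *
    linear_combination (algebraMap ℂ K Complex.I * ((∏ r ∈ Finset.Icc 1 k, w r) *
      ∏ r ∈ Finset.Icc 1 (k + 1), y r) * B / P) * key
  · rw [show p + -1 + 1 / 2 = p - 1 / 2 by ring, show p + -1 - 1 / 2 = p - 3 / 2 by ring]
    have key : (-1 / 2 - -1 * p + 1) / ((p + 1 / 2) * (p - 1 / 2)) +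
        (-1 * p - -1 / 2 + 1) / ((p - 1 / 2) * (p - 3 / 2)) = 0 := by
      rw [show -1 / 2 - -1 * p + 1 = p + 1 / 2 by ring,
        show -1 * p - -1 / 2 + 1 = -(p - 3 / 2) by ring]
      generalize p + 1 / 2 = a at *
      generalize p - 1 / 2 = b at *
      generalize p - 3 / 2 = c at *
      field_simp
      ring
    generalize (p + 1 / 2) * (p - 1 / 2) = d at *
    generalize (p - 1 / 2) * (p - 3 / 2) = d' at *
    linear_combination (algebraMap ℂ K Complex.I * ((∏ r ∈ Finset.Icc 1 k, w r) *
      ∏ r ∈ Finset.Icc 1 (k + 1), y r) * B / P) * key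

theorem evenCoef_antisymm [CharZero K] [Algebra ℂ K] {k : ℕ} (w y : ℕ → K) {x : ℕ → K}
    (hx : GenericRow k x) {ε δ : ℤ} (hε : ε ∈ Finset.Icc (-k : ℤ) k)
    (hδ : δ ∈ Finset.Icc (-k : ℤ) k) (h : δ ≠ ε) (h' : δ ≠ -ε) :
    evenCoef k w x y ε * evenCoef k w (bump ε x) y δ * (signedEntry x ε - signedEntry x δ + 1) +
      evenCoef k w x y δ * evenCoef k w (bump δ x) y ε *
        (signedEntry x δ - signedEntry x ε + 1) = 0 := by
  rcases eq_or_ne ε 0 with rfl | hε0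
  · rw [bump_zero, signedEntry_zero]
    exact evenCoef_antisymm_zero w y hx hδ h
  rcases eq_or_ne δ 0 with rfl | hδ0
  · rw [bump_zero, signedEntry_zero, add_comm]
    exact evenCoef_antisymm_zero w y hx hε hε0
  have hne : ε.natAbs ≠ δ.natAbs := by omega
  have hadd := hx.add _ (natAbs_mem hε hε0) _ (natAbs_mem hδ hδ0) hne
  have hsub := hx.sub _ (natAbs_mem hε hε0) _ (natAbs_mem hδ hδ0) hne
  refine signedCoef_antisymm _ _ _ _ _ _ x hε hδ hε0 hδ0 h h' ?_
  generalize x ε.natAbs = p at *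
  generalize x δ.natAbs = q at *
  have a0 : p + q ≠ 0 := fun e => hadd 0 (by rw [e]; simp)
  have a1 : p + q + 1 ≠ 0 := fun e => hadd (-2) (by push_cast; linear_combination e)
  have a2 : p + q - 1 ≠ 0 := fun e => hadd 2 (by push_cast; linear_combination e)
  have s0 : p - q ≠ 0 := fun e => hsub 0 (by rw [e]; simp)
  have s1 : p - q + 1 ≠ 0 := fun e => hsub (-2) (by push_cast; linear_combination e)
  have s2 : p - q - 1 ≠ 0 := fun e => hsub 2 (by push_cast; linear_combination e)
  unfold evenDen
  rw [show p ^ 2 - q ^ 2 = (p - q) * (p + q) by ring,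
    show q ^ 2 - p ^ 2 = -((p - q) * (p + q)) by ring]
  rcases sign_cases hε0 with e | e <;> rcases sign_cases hδ0 with e' | e' <;> rw [e, e'] <;>
    push_cast
  · rw [show q ^ 2 - (p + 1) ^ 2 = -((p - q + 1) * (p + q + 1)) by ring,
      show p ^ 2 - (q + 1) ^ 2 = (p - q - 1) * (p + q + 1) by ring]
    field_simp
    ring
  · rw [show q ^ 2 - (p + 1) ^ 2 = -((p - q + 1) * (p + q + 1)) by ring,
      show p ^ 2 - (q + -1) ^ 2 = (p - q + 1) * (p + q - 1) by ring]
    field_simp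
    ring
  · rw [show q ^ 2 - (p + -1) ^ 2 = -((p - q - 1) * (p + q - 1)) by ring,
      show p ^ 2 - (q + 1) ^ 2 = (p - q - 1) * (p + q + 1) by ring]
    field_simp
    ring
  · rw [show q ^ 2 - (p + -1) ^ 2 = -((p - q - 1) * (p + q - 1)) by ring,
      show p ^ 2 - (q + -1) ^ 2 = (p - q + 1) * (p + q - 1) by ring]
    field_simp
    ring

end Rows


section Interpolation

variable {K : Type*} [Field K]

theorem prod_erase_signed {k : ℕ} {ε : ℤ} (hε : ε ∈ Finset.Icc (-k : ℤ) k) (h : ε ≠ 0)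
    (f : ℤ → K) : ∏ δ ∈ (Finset.Icc (-k : ℤ) k).erase ε, f δ =
      f (-ε) * f 0 * ∏ r ∈ (Finset.Icc 1 k).erase ε.natAbs, (f r * f (-r)) := by
  have hj := natAbs_mem hε h
  have h1 : ∏ δ ∈ (Finset.Icc (-k : ℤ) k).erase ε, f δ =
      ∏ δ ∈ Finset.Icc (-k : ℤ) k, Function.update f ε 1 δ := by
    rw [← Finset.mul_prod_erase _ _ hε, Function.update_self, one_mul]
    exact Finset.prod_congr rfl fun δ hδ => by
      rw [Function.update_of_ne (Finset.ne_of_mem_erase hδ)]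
  rw [h1, prod_signed, ← Finset.prod_mul_distrib, ← Finset.mul_prod_erase _ _ hj,
    Function.update_of_ne h.symm]
  have h2 : Function.update f ε 1 ε.natAbs * Function.update f ε 1 (-(ε.natAbs : ℤ)) = f (-ε) := by
    rcases Int.natAbs_eq ε with e | e
    · rw [← e, Function.update_self, one_mul, Function.update_of_ne (by omega)]
    · rw [← e, Function.update_self, mul_one, Function.update_of_ne (by omega),
        show (ε.natAbs : ℤ) = -ε by omega]
  rw [h2]
  have h3 : ∏ r ∈ (Finset.Icc 1 k).erase ε.natAbs,
      (Function.update f ε 1 r * Function.update f ε 1 (-(r : ℤ))) =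
      ∏ r ∈ (Finset.Icc 1 k).erase ε.natAbs, (f r * f (-r)) := by
    refine Finset.prod_congr rfl fun r hr => ?_
    have := Finset.ne_of_mem_erase hr
    rw [Function.update_of_ne (by omega), Function.update_of_ne (by omega)]
  rw [h3]
  ring

theorem prod_erase_erase_signed {k : ℕ} {ε : ℤ} (hε : ε ∈ Finset.Icc (-k : ℤ) k) (h : ε ≠ 0)
    (f : ℤ → K) : ∏ δ ∈ ((Finset.Icc (-k : ℤ) k).erase 0).erase ε, f δ =
      f (-ε) * ∏ r ∈ (Finset.Icc 1 k).erase ε.natAbs, (f r * f (-r)) := by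
  have h1 := prod_erase_signed hε h (Function.update f 0 1)
  rw [Function.update_self, mul_one, Function.update_of_ne (by omega)] at h1
  have h0 : (0 : ℤ) ∈ (Finset.Icc (-k : ℤ) k).erase ε := by
    rw [Finset.mem_erase, Finset.mem_Icc]
    omega
  rw [← Finset.mul_prod_erase _ _ h0, Function.update_self, one_mul] at h1
  rw [Finset.erase_right_comm]
  convert h1 using 1
  · exact Finset.prod_congr rfl fun δ hδ => by
      rw [Function.update_of_ne (Finset.ne_of_mem_erase hδ)]
  · congr 1
    refine Finset.prod_congr rfl fun r hr => ?_
    have := (Finset.mem_Icc.1 (Finset.mem_of_mem_erase hr)).1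
    rw [Function.update_of_ne (by omega), Function.update_of_ne (by omega)]

/-- The interpolation node with signed index `ε`. -/
def node (x : ℕ → K) (ε : ℤ) : K := (signedEntry x ε + 1 / 2) ^ 2

theorem node_zero [CharZero K] (x : ℕ → K) : node x 0 = 0 := by
  rw [node, signedEntry_zero]
  norm_num

theorem node_of_ne {ε : ℤ} (h : ε ≠ 0) (x : ℕ → K) :
    node x ε = (x ε.natAbs + ε.sign / 2) ^ 2 := by
  rw [node, signedEntry_of_ne h]
  rcases sign_cases h with e | e <;> rw [e] <;> push_cast <;> ring

theorem node_natCast {r : ℕ} (h : r ≠ 0) (x : ℕ → K) : node x r = (x r + 1 / 2) ^ 2 := by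
  rw [node_of_ne (by omega), Int.natAbs_natCast, Int.sign_natCast_of_ne_zero h]
  simp

theorem node_neg_natCast {r : ℕ} (h : r ≠ 0) (x : ℕ → K) : node x (-r) = (x r - 1 / 2) ^ 2 := by
  rw [node_of_ne (by omega), Int.natAbs_neg, Int.natAbs_natCast, Int.sign_neg,
    Int.sign_natCast_of_ne_zero h]
  push_cast
  ring

theorem node_injOn [CharZero K] {k : ℕ} {x : ℕ → K} (hx : GenericRow k x) :
    Set.InjOn (node x) (Finset.Icc (-k : ℤ) k) := by
  intro ε hε δ hδ h
  rw [Finset.mem_coe] at hε hδ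
  by_contra hne
  have aux : ∀ ε ∈ Finset.Icc (-k : ℤ) k, ε ≠ 0 → node x ε ≠ 0 := by
    intro ε hε h0 e
    rw [node_of_ne h0] at e
    refine hx.entry _ (natAbs_mem hε h0) (-ε.sign) ?_
    push_cast
    linear_combination pow_eq_zero_iff (two_ne_zero) |>.1 e
  rcases eq_or_ne ε 0 with rfl | hε0
  · rw [node_zero] at h
    exact aux δ hδ (Ne.symm hne) h.symm
  rcases eq_or_ne δ 0 with rfl | hδ0
  · rw [node_zero] at h
    exact aux ε hε hε0 h
  have hj := natAbs_mem hε hε0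
  have hi := natAbs_mem hδ hδ0
  rw [node_of_ne hε0, node_of_ne hδ0, sq_eq_sq_iff_eq_or_eq_neg] at h
  by_cases hij : ε.natAbs = δ.natAbs
  · have hδ : δ = -ε := by omega
    subst hδ
    rw [Int.natAbs_neg, Int.sign_neg] at h
    rcases h with h | h
    · rcases sign_cases hε0 with e | e <;> rw [e] at h <;> push_cast at h
      · exact one_ne_zero (α := K) (by linear_combination h)
      · exact one_ne_zero (α := K) (by linear_combination -h)
    · refine hx.entry _ hj 0 ?_
      push_cast at h ⊢
      linear_combination h / 2
  · rcases h with h | h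
    · refine hx.sub _ hj _ hi hij (δ.sign - ε.sign) ?_
      push_cast
      linear_combination h
    · refine hx.add _ hj _ hi hij (-δ.sign - ε.sign) ?_
      push_cast
      linear_combination h

/-- The polynomial interpolated for `I_{2k+1,2k}`. -/
def oddPoly (k : ℕ) (w y : ℕ → K) : Polynomial K :=
  (Polynomial.X - Polynomial.C (1 / 4)) *
    ((∏ r ∈ Finset.Icc 1 (k - 1), (Polynomial.X - Polynomial.C (w r ^ 2))) *
      ∏ r ∈ Finset.Icc 1 k, (Polynomial.X - Polynomial.C (y r ^ 2)))

/-- The polynomial interpolated for `I_{2k+2,2k+1}`. -/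
def evenPoly (k : ℕ) (w y : ℕ → K) : Polynomial K :=
  (∏ r ∈ Finset.Icc 1 k, (Polynomial.X - Polynomial.C (w r ^ 2))) *
    ∏ r ∈ Finset.Icc 1 (k + 1), (Polynomial.X - Polynomial.C (y r ^ 2))

theorem oddPoly_eval (k : ℕ) (w y : ℕ → K) (z : K) : (oddPoly k w y).eval z =
    (z - 1 / 4) * ((∏ r ∈ Finset.Icc 1 (k - 1), (z - w r ^ 2)) *
      ∏ r ∈ Finset.Icc 1 k, (z - y r ^ 2)) := by
  simp [oddPoly, Polynomial.eval_prod]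

theorem evenPoly_eval (k : ℕ) (w y : ℕ → K) (z : K) : (evenPoly k w y).eval z =
    (∏ r ∈ Finset.Icc 1 k, (z - w r ^ 2)) * ∏ r ∈ Finset.Icc 1 (k + 1), (z - y r ^ 2) := by
  simp [evenPoly, Polynomial.eval_prod]

theorem natDegree_prod_linear (S : Finset ℕ) (f : ℕ → K) :
    (∏ r ∈ S, (Polynomial.X - Polynomial.C (f r))).natDegree = S.card := by
  rw [Polynomial.natDegree_prod_of_monic _ _ fun _ _ => Polynomial.monic_X_sub_C _]
  simp

theorem monic_prod_linear (S : Finset ℕ) (f : ℕ → K) :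
    (∏ r ∈ S, (Polynomial.X - Polynomial.C (f r))).Monic :=
  Polynomial.monic_prod_of_monic _ _ fun _ _ => Polynomial.monic_X_sub_C _

theorem oddPoly_monic (k : ℕ) (w y : ℕ → K) : (oddPoly k w y).Monic :=
  (Polynomial.monic_X_sub_C _).mul ((monic_prod_linear _ _).mul (monic_prod_linear _ _))

theorem evenPoly_monic (k : ℕ) (w y : ℕ → K) : (evenPoly k w y).Monic :=
  (monic_prod_linear _ _).mul (monic_prod_linear _ _)

theorem oddPoly_natDegree {k : ℕ} (hk : 1 ≤ k) (w y : ℕ → K) :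
    (oddPoly k w y).natDegree = ((Finset.Icc (-k : ℤ) k).erase 0).card := by
  rw [oddPoly, (Polynomial.monic_X_sub_C _).natDegree_mul
    ((monic_prod_linear _ _).mul (monic_prod_linear _ _)),
    (monic_prod_linear _ _).natDegree_mul (monic_prod_linear _ _), natDegree_prod_linear,
    natDegree_prod_linear, Polynomial.natDegree_X_sub_C, Finset.card_erase_of_mem (by simp)]
  simp only [Nat.card_Icc, Int.card_Icc]
  omega

theorem evenPoly_natDegree (k : ℕ) (w y : ℕ → K) :
    (evenPoly k w y).natDegree = (Finset.Icc (-k : ℤ) k).card := by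
  rw [evenPoly, (monic_prod_linear _ _).natDegree_mul (monic_prod_linear _ _),
    natDegree_prod_linear, natDegree_prod_linear]
  simp only [Nat.card_Icc, Int.card_Icc]
  omega

/-- The product of two opposite coefficients. -/
theorem signedCoef_mul_neg {k : ℕ} (N : ℤ → K → K) (D : ℤ → K → K → K) (c d : K) (x : ℕ → K)
    {ε : ℤ} (h : ε ≠ 0)
    (hD : ∀ q, D ε.sign (x ε.natAbs) q * D (-ε.sign) (x ε.natAbs + ε.sign) q =
      ((x ε.natAbs + ε.sign / 2) ^ 2 - (q + 1 / 2) ^ 2) *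
        ((x ε.natAbs + ε.sign / 2) ^ 2 - (q - 1 / 2) ^ 2)) :
    signedCoef k N D c x ε * signedCoef k N D d (bump ε x) (-ε) =
      N ε.sign (x ε.natAbs) * N (-ε.sign) (x ε.natAbs + ε.sign) /
        ∏ r ∈ (Finset.Icc 1 k).erase ε.natAbs,
          ((node x ε - node x r) * (node x ε - node x (-r))) := by
  rw [signedCoef_of_ne h, signedCoef_of_ne (neg_ne_zero.2 h), Int.natAbs_neg, Int.sign_neg,
    bump_natAbs, div_mul_div_comm, ← Finset.prod_mul_distrib]
  congr 1
  refine Finset.prod_congr rfl fun r hr => ?_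
  have h0 : r ≠ 0 := by
    have := (Finset.mem_Icc.1 (Finset.mem_of_mem_erase hr)).1
    omega
  rw [bump_of_ne (Finset.ne_of_mem_erase hr), hD, node_of_ne h, node_natCast h0,
    node_neg_natCast h0]

theorem oddCoef_mul_neg [CharZero K] {k : ℕ} (w y : ℕ → K) {x : ℕ → K} (hx : GenericRow k x)
    {ε : ℤ} (hε : ε ∈ (Finset.Icc (-k : ℤ) k).erase 0) :
    oddCoef k w x y ε * oddCoef k w (bump ε x) y (-ε) *
        (signedEntry x ε - signedEntry (bump ε x) (-ε) + 1) =
      (oddPoly k w y).eval (node x ε) /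
        ∏ δ ∈ ((Finset.Icc (-k : ℤ) k).erase 0).erase ε, (node x ε - node x δ) := by
  rw [Finset.mem_erase] at hε
  have hp : x ε.natAbs ≠ 0 := fun e => hx.entry _ (natAbs_mem hε.2 hε.1) 0 (by rw [e]; simp)
  unfold oddCoef
  rw [prod_erase_erase_signed hε.2 hε.1, signedCoef_mul_neg _ _ _ _ _ hε.1, signedEntry_neg_bump,
    oddPoly_eval, signedEntry_of_ne hε.1]
  · generalize ∏ r ∈ (Finset.Icc 1 k).erase ε.natAbs,
      ((node x ε - node x r) * (node x ε - node x (-r))) = P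
    rw [node_of_ne hε.1, node_of_ne (neg_ne_zero.2 hε.1), Int.natAbs_neg, Int.sign_neg]
    generalize x ε.natAbs = p at *
    rcases sign_cases hε.1 with e | e <;> rw [e] <;>
      simp only [oddNum, if_true, neg_neg, show ¬ (-1 : ℤ) = 1 by decide, if_false]
    · have e1 : ∏ r ∈ Finset.Icc 1 (k - 1), ((p + (1 : ℤ) / 2) ^ 2 - w r ^ 2) =
          (∏ r ∈ Finset.Icc 1 (k - 1), (w r + p + 1 / 2)) *
            ∏ r ∈ Finset.Icc 1 (k - 1), (p + (1 : ℤ) - w r - 1 / 2) := by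
        rw [← Finset.prod_mul_distrib]
        exact Finset.prod_congr rfl fun r _ => by push_cast; ring
      have e2 : ∏ r ∈ Finset.Icc 1 k, ((p + (1 : ℤ) / 2) ^ 2 - y r ^ 2) =
          (∏ r ∈ Finset.Icc 1 k, (p - y r + 1 / 2)) *
            ∏ r ∈ Finset.Icc 1 k, (y r + (p + (1 : ℤ)) - 1 / 2) := by
        rw [← Finset.prod_mul_distrib]
        exact Finset.prod_congr rfl fun r _ => by push_cast; ring
      rw [e1, e2]
      generalize ∏ r ∈ Finset.Icc 1 (k - 1), (w r + p + 1 / 2) = W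
      generalize ∏ r ∈ Finset.Icc 1 (k - 1), (p + (1 : ℤ) - w r - 1 / 2) = W'
      generalize ∏ r ∈ Finset.Icc 1 k, (p - y r + 1 / 2) = Y
      generalize ∏ r ∈ Finset.Icc 1 k, (y r + (p + (1 : ℤ)) - 1 / 2) = Y'
      push_cast
      rw [show (p + 1 / 2) ^ 2 - (p + -1 / 2) ^ 2 = 2 * p by ring]
      field_simp
      ring
    · have e1 : ∏ r ∈ Finset.Icc 1 (k - 1), ((p + (-1 : ℤ) / 2) ^ 2 - w r ^ 2) =
          (∏ r ∈ Finset.Icc 1 (k - 1), (w r + (p + (-1 : ℤ)) + 1 / 2)) *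
            ∏ r ∈ Finset.Icc 1 (k - 1), (p - w r - 1 / 2) := by
        rw [← Finset.prod_mul_distrib]
        exact Finset.prod_congr rfl fun r _ => by push_cast; ring
      have e2 : ∏ r ∈ Finset.Icc 1 k, ((p + (-1 : ℤ) / 2) ^ 2 - y r ^ 2) =
          (∏ r ∈ Finset.Icc 1 k, (p + (-1 : ℤ) - y r + 1 / 2)) *
            ∏ r ∈ Finset.Icc 1 k, (y r + p - 1 / 2) := by
        rw [← Finset.prod_mul_distrib]
        exact Finset.prod_congr rfl fun r _ => by push_cast; ring
      rw [e1, e2]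
      generalize ∏ r ∈ Finset.Icc 1 (k - 1), (w r + (p + (-1 : ℤ)) + 1 / 2) = W
      generalize ∏ r ∈ Finset.Icc 1 (k - 1), (p - w r - 1 / 2) = W'
      generalize ∏ r ∈ Finset.Icc 1 k, (p + (-1 : ℤ) - y r + 1 / 2) = Y
      generalize ∏ r ∈ Finset.Icc 1 k, (y r + p - 1 / 2) = Y'
      push_cast
      rw [show (p + -1 / 2) ^ 2 - (p + 1 / 2) ^ 2 = -(2 * p) by ring]
      field_simp
      ring
  · intro q
    unfold oddDen
    rcases sign_cases hε.1 with e | e <;> rw [e] <;> push_cast <;> ring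

theorem oddCoef_sum [CharZero K] {k : ℕ} (hk : 1 ≤ k) (w y : ℕ → K) {x : ℕ → K}
    (hx : GenericRow k x) (c : K)
    (hc : (oddPoly k w y).eval (c ^ 2) = 0)
    (hxc : ∀ ε ∈ (Finset.Icc (-k : ℤ) k).erase 0, node x ε - c ^ 2 ≠ 0) :
    ∑ ε ∈ (Finset.Icc (-k : ℤ) k).erase 0, oddCoef k w x y ε * oddCoef k w (bump ε x) y (-ε) *
        (signedEntry x ε - signedEntry (bump ε x) (-ε) + 1) /
          ((signedEntry x ε + 1 / 2) ^ 2 - c ^ 2) = 1 := by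
  refine Eq.trans ?_ (sum_eval_div_eq_one _ (node x) ((node_injOn hx).mono (by simp)) _
    (oddPoly_monic k w y) (oddPoly_natDegree hk w y) (c ^ 2) hc hxc)
  exact Finset.sum_congr rfl fun ε hε => by rw [oddCoef_mul_neg w y hx hε, node]

theorem evenCoef_mul_neg [CharZero K] [Algebra ℂ K] {k : ℕ} (w y : ℕ → K) {x : ℕ → K}
    (hx : GenericRow k x) {ε : ℤ} (hε : ε ∈ Finset.Icc (-k : ℤ) k) :
    evenCoef k w x y ε * evenCoef k w (bump ε x) y (-ε) *
        (signedEntry x ε - signedEntry (bump ε x) (-ε) + 1) =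
      (evenPoly k w y).eval (node x ε) /
        ∏ δ ∈ (Finset.Icc (-k : ℤ) k).erase ε, (node x ε - node x δ) := by
  unfold evenCoef
  rcases eq_or_ne ε 0 with rfl | h
  · have h0 : ∏ δ ∈ (Finset.Icc (-k : ℤ) k).erase 0, (node x 0 - node x δ) =
        ∏ r ∈ Finset.Icc 1 k, ((x r + 1 / 2) * (x r - 1 / 2)) ^ 2 := by
      have h1 := prod_signed k (Function.update (fun δ => node x 0 - node x δ) 0 1)
      rw [← Finset.mul_prod_erase _ _ (show (0 : ℤ) ∈ Finset.Icc (-k : ℤ) k by simp),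
        Function.update_self, one_mul, mul_one, ← Finset.prod_mul_distrib] at h1
      refine (Finset.prod_congr rfl fun δ hδ =>
        (Function.update_of_ne (Finset.ne_of_mem_erase hδ) 1
          fun δ => node x 0 - node x δ).symm).trans (h1.trans ?_)
      refine Finset.prod_congr rfl fun r hr => ?_
      have hr0 : r ≠ 0 := by
        have := (Finset.mem_Icc.1 hr).1
        omega
      rw [Function.update_of_ne (by omega), Function.update_of_ne (by omega), node_zero,
        node_natCast hr0, node_neg_natCast hr0]
      ring
    have hI : algebraMap ℂ K Complex.I * algebraMap ℂ K Complex.I = -1 := by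
      rw [← map_mul, Complex.I_mul_I, map_neg, map_one]
    rw [h0, bump_zero, neg_zero, signedCoef_zero, sub_self, zero_add, mul_one, evenPoly_eval,
      node_zero, Finset.prod_pow]
    simp only [zero_sub, Finset.prod_neg, Finset.prod_pow, Nat.card_Icc, Nat.add_sub_cancel]
    generalize ∏ r ∈ Finset.Icc 1 k, ((x r + 1 / 2) * (x r - 1 / 2)) = P
    generalize ∏ r ∈ Finset.Icc 1 k, w r = W
    generalize ∏ r ∈ Finset.Icc 1 (k + 1), y r = Y
    have hs : (-1 : K) ^ k * (-1) ^ k = 1 := by rw [← mul_pow]; simp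
    rw [pow_succ]
    linear_combination (W * Y / P) ^ 2 * hI + (W * Y / P) ^ 2 * hs
  have hpe := hx.entry _ (natAbs_mem hε h)
  rw [prod_erase_signed hε h, signedCoef_mul_neg _ _ _ _ _ h, signedEntry_neg_bump,
    evenPoly_eval, signedEntry_of_ne h]
  · generalize ∏ r ∈ (Finset.Icc 1 k).erase ε.natAbs,
      ((node x ε - node x r) * (node x ε - node x (-r))) = P
    rw [node_of_ne h, node_of_ne (neg_ne_zero.2 h), Int.natAbs_neg, Int.sign_neg, node_zero]
    generalize x ε.natAbs = p at *
    have hp : p ≠ 0 := fun e => hpe 0 (by rw [e]; simp)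
    rcases sign_cases h with e | e <;> rw [e] <;>
      simp only [evenNum, if_true, neg_neg, show ¬ (-1 : ℤ) = 1 by decide, if_false] <;>
      push_cast
    · have a1 : p + 1 ≠ 0 := fun e => hpe (-2) (by push_cast; linear_combination e)
      have a2 : p + 1 / 2 ≠ 0 := fun e => hpe (-1) (by push_cast; linear_combination e)
      rw [show p + 1 - 1 / 2 = p + 1 / 2 by ring,
        show (p + 1 / 2) ^ 2 - (p + -1 / 2) ^ 2 = 2 * p by ring,
        show 1 * p - (-(1 * p) - 1) + 1 = 2 * (p + 1) by ring, sub_zero]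
      generalize p + 1 / 2 = z at *
      generalize ∏ r ∈ Finset.Icc 1 (k + 1), (z ^ 2 - y r ^ 2) = Y
      generalize ∏ r ∈ Finset.Icc 1 k, (z ^ 2 - w r ^ 2) = W
      field_simp
    · have a1 : p - 1 ≠ 0 := fun e => hpe 2 (by push_cast; linear_combination e)
      have a2 : p - 1 / 2 ≠ 0 := fun e => hpe 1 (by push_cast; linear_combination e)
      rw [show p + -1 + 1 / 2 = p - 1 / 2 by ring, show p + -1 / 2 = p - 1 / 2 by ring,
        show (p - 1 / 2) ^ 2 - (p + 1 / 2) ^ 2 = -(2 * p) by ring,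
        show -1 * p - (-(-1 * p) - 1) + 1 = -(2 * (p - 1)) by ring, sub_zero,
        show p + -1 = p - 1 by ring]
      generalize p - 1 / 2 = z at *
      generalize ∏ r ∈ Finset.Icc 1 (k + 1), (z ^ 2 - y r ^ 2) = Y
      generalize ∏ r ∈ Finset.Icc 1 k, (z ^ 2 - w r ^ 2) = W
      generalize p - 1 = q at *
      field_simp
  · intro q
    unfold evenDen
    rcases sign_cases h with e | e <;> rw [e] <;> push_cast <;> ring

theorem evenCoef_sum [CharZero K] [Algebra ℂ K] {k : ℕ} (w y : ℕ → K) {x : ℕ → K}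
    (hx : GenericRow k x) (c : K) (hc : (evenPoly k w y).eval (c ^ 2) = 0)
    (hxc : ∀ ε ∈ Finset.Icc (-k : ℤ) k, node x ε - c ^ 2 ≠ 0) :
    ∑ ε ∈ Finset.Icc (-k : ℤ) k, evenCoef k w x y ε * evenCoef k w (bump ε x) y (-ε) *
        (signedEntry x ε - signedEntry (bump ε x) (-ε) + 1) /
          ((signedEntry x ε + 1 / 2) ^ 2 - c ^ 2) = 1 := by
  refine Eq.trans ?_ (sum_eval_div_eq_one _ (node x) (node_injOn hx) _ (evenPoly_monic k w y)
    (evenPoly_natDegree k w y) (c ^ 2) hc hxc)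
  exact Finset.sum_congr rfl fun ε hε => by rw [evenCoef_mul_neg w y hx hε, node]

end Interpolation


/-! ### The generators as operators on functions on a lattice of points -/

section Points

variable {K : Type*} [Field K]

/-- The signed indices of the terms of `I_{s+1,s}`. -/
def signedIdx (s : ℕ) : Finset ℤ :=
  if Even s then (Finset.Icc (-(s / 2 : ℕ) : ℤ) (s / 2 : ℕ)).erase 0
  else Finset.Icc (-(s / 2 : ℕ) : ℤ) (s / 2 : ℕ)

/-- The coefficients of `I_{s+1,s}` at the point `m`. -/
def coef [Algebra ℂ K] (s : ℕ) (m : ℕ → ℕ → K) : ℤ → K :=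
  if Even s then oddCoef (s / 2) (m (s - 2)) (m (s - 1)) (m s)
  else evenCoef (s / 2) (m (s - 2)) (m (s - 1)) (m s)

/-- The polynomial interpolated for `I_{s+1,s}`. -/
def genPoly (s : ℕ) (m : ℕ → ℕ → K) : Polynomial K :=
  if Even s then oddPoly (s / 2) (m (s - 2)) (m s) else evenPoly (s / 2) (m (s - 2)) (m s)

/-- The point `m` with the row `p` shifted by a signed unit vector. -/
def bumpPoint (p : ℕ) (ε : ℤ) (m : ℕ → ℕ → K) : ℕ → ℕ → K := Function.update m p (bump ε (m p))

theorem bumpPoint_self (p : ℕ) (ε : ℤ) (m : ℕ → ℕ → K) : bumpPoint p ε m p = bump ε (m p) :=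
  Function.update_self ..

theorem bumpPoint_of_ne {p q : ℕ} (h : q ≠ p) (ε : ℤ) (m : ℕ → ℕ → K) :
    bumpPoint p ε m q = m q := Function.update_of_ne h ..

theorem mem_of_mem_signedIdx {s : ℕ} {ε : ℤ} (h : ε ∈ signedIdx s) :
    ε ∈ Finset.Icc (-(s / 2 : ℕ) : ℤ) (s / 2 : ℕ) := by
  unfold signedIdx at h
  split_ifs at h
  · exact Finset.mem_of_mem_erase h
  · exact h

theorem ne_zero_of_mem_signedIdx {s : ℕ} (hs : Even s) {ε : ℤ} (h : ε ∈ signedIdx s) :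
    ε ≠ 0 := by
  rw [signedIdx, if_pos hs] at h
  exact Finset.ne_of_mem_erase h

theorem ne_zero_or_ne_zero {s : ℕ} {ε β : ℤ} (hε : ε ∈ signedIdx s)
    (hβ : β ∈ signedIdx (s + 1)) : ε ≠ 0 ∨ β ≠ 0 := by
  rcases Nat.even_or_odd s with h | h
  · exact Or.inl (ne_zero_of_mem_signedIdx h hε)
  · exact Or.inr (ne_zero_of_mem_signedIdx h.add_one hβ)

theorem neg_mem_signedIdx {s : ℕ} {ε : ℤ} (h : ε ∈ signedIdx s) : -ε ∈ signedIdx s := by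
  unfold signedIdx at *
  split_ifs at *
  · rw [Finset.mem_erase] at *
    exact ⟨neg_ne_zero.2 h.1, neg_mem_signed h.2⟩
  · exact neg_mem_signed h

variable [Algebra ℂ K]

theorem coef_congr {s : ℕ} {m m' : ℕ → ℕ → K} (h2 : m (s - 2) = m' (s - 2))
    (h1 : m (s - 1) = m' (s - 1)) (h0 : m s = m' s) : coef s m = coef s m' := by
  unfold coef
  rw [h2, h1, h0]

theorem coef_mul_coef [CharZero K] {s : ℕ} (hs : 1 ≤ s) (m : ℕ → ℕ → K) {ε β : ℤ}
    (hε : ε ∈ signedIdx s) (hβ : β ∈ signedIdx (s + 1)) :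
    coef s (bumpPoint s β m) ε * coef (s + 1) m β *
        (signedEntry (m (s - 1)) ε - signedEntry (m s) β + 1 / 2) =
      coef s m ε * coef (s + 1) (bumpPoint (s - 1) ε m) β *
        (signedEntry (m (s - 1)) ε - signedEntry (m s) β - 1 / 2) := by
  have hε' := mem_of_mem_signedIdx hε
  have hβ' := mem_of_mem_signedIdx hβ
  unfold coef
  simp only [Nat.add_sub_cancel, show s + 1 - 2 = s - 1 by omega, bumpPoint_self]
  rw [bumpPoint_of_ne (show s - 1 ≠ s by omega), bumpPoint_of_ne (show s ≠ s - 1 by omega),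
    bumpPoint_of_ne (show s + 1 ≠ s - 1 by omega)]
  rcases Nat.even_or_odd s with h | h
  · have h' : ¬ Even (s + 1) := by rw [Nat.even_add_one]; simpa using h
    have h2 : 2 ≤ s := by obtain ⟨r, rfl⟩ := h; omega
    have e : (s + 1) / 2 = s / 2 := by obtain ⟨r, rfl⟩ := h; omega
    rw [e] at hβ'
    simp only [if_pos h, if_neg h', e]
    rw [bumpPoint_of_ne (show s - 2 ≠ s by omega)]
    exact oddCoef_mul_evenCoef _ _ _ _ hε' hβ'
  · have h' : Even (s + 1) := h.add_one
    have e : (s + 1) / 2 = s / 2 + 1 := by obtain ⟨r, rfl⟩ := h; omega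
    rw [e] at hβ'
    simp only [if_neg (Nat.not_even_iff_odd.2 h), if_pos h', e]
    rw [bumpPoint_of_ne (show s - 2 ≠ s by omega)]
    exact evenCoef_mul_oddCoef _ _ _ _ hε' hβ'

theorem coef_antisymm [CharZero K] {s : ℕ} (hs : 1 ≤ s) {m : ℕ → ℕ → K}
    (hm : GenericRow (s / 2) (m (s - 1))) {ε δ : ℤ}
    (hε : ε ∈ signedIdx s) (hδ : δ ∈ signedIdx s) (h : δ ≠ ε) (h' : δ ≠ -ε) :
    coef s m ε * coef s (bumpPoint (s - 1) ε m) δ *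
        (signedEntry (m (s - 1)) ε - signedEntry (m (s - 1)) δ + 1) +
      coef s m δ * coef s (bumpPoint (s - 1) δ m) ε *
        (signedEntry (m (s - 1)) δ - signedEntry (m (s - 1)) ε + 1) = 0 := by
  unfold coef
  simp only [bumpPoint_self, bumpPoint_of_ne (show s ≠ s - 1 by omega)]
  unfold signedIdx at hε hδ
  split_ifs at hε hδ ⊢ with he
  · have h2 : 2 ≤ s := by obtain ⟨r, rfl⟩ := he; omega
    simp only [bumpPoint_of_ne (show s - 2 ≠ s - 1 by omega)]
    exact oddCoef_antisymm _ _ hm hε hδ h h'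
  · rcases eq_or_ne s 1 with rfl | h1
    · simp at hε hδ
      omega
    simp only [bumpPoint_of_ne (show s - 2 ≠ s - 1 by omega)]
    exact evenCoef_antisymm _ _ hm hε hδ h h'

theorem coef_sum [CharZero K] {s : ℕ} (hs : 1 ≤ s) {m : ℕ → ℕ → K}
    (hm : GenericRow (s / 2) (m (s - 1))) (c : K) (hc : (genPoly s m).eval (c ^ 2) = 0)
    (hmc : ∀ ε ∈ signedIdx s, node (m (s - 1)) ε - c ^ 2 ≠ 0) :
    ∑ ε ∈ signedIdx s, coef s m ε * coef s (bumpPoint (s - 1) ε m) (-ε) *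
        (signedEntry (m (s - 1)) ε - signedEntry (bumpPoint (s - 1) ε m (s - 1)) (-ε) + 1) /
          ((signedEntry (m (s - 1)) ε + 1 / 2) ^ 2 - c ^ 2) = 1 := by
  unfold coef
  simp only [bumpPoint_self, bumpPoint_of_ne (show s ≠ s - 1 by omega)]
  unfold signedIdx at hmc ⊢
  unfold genPoly at hc
  split_ifs at hc hmc ⊢ with he
  · have h2 : 2 ≤ s := by obtain ⟨r, rfl⟩ := he; omega
    simp only [bumpPoint_of_ne (show s - 2 ≠ s - 1 by omega)]
    exact oddCoef_sum (by omega) _ _ hm c hc hmc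
  · rcases eq_or_ne s 1 with rfl | h1
    · have := evenCoef_sum (m (1 - 2)) (m 1) hm c hc hmc
      simpa [bump_zero, bumpPoint] using this
    simp only [bumpPoint_of_ne (show s - 2 ≠ s - 1 by omega)]
    exact evenCoef_sum _ _ hm c hc hmc

end Points

section Lattice

variable {K : Type*} [Field K] {n : ℕ}

/-- The point with integral displacement `l` from the base point `z`. -/
def point (z : Entry n → K) (l : Entry n → ℤ) : ℕ → ℕ → K := extend fun t => z t + l t

/-- The signed unit vectors in row `p`. -/
def unitVec (n p : ℕ) (ε : ℤ) : Entry n → ℤ := fun t =>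
  if t.1 = (p, ε.natAbs) then ε.sign else 0

/-- No half integers among the entries, their sums and their differences. -/
structure Generic (z : Entry n → K) : Prop where
  entry : ∀ t, ∀ c : ℤ, z t ≠ c / 2
  add : ∀ t u, t ≠ u → ∀ c : ℤ, z t + z u ≠ c / 2
  sub : ∀ t u, t ≠ u → ∀ c : ℤ, z t - z u ≠ c / 2

theorem Generic.translate [CharZero K] {z : Entry n → K} (hz : Generic z) (l : Entry n → ℤ) :
    Generic fun t => z t + l t where
  entry t c h := hz.entry t (c - 2 * l t) (by push_cast; linear_combination h)
  add t u htu c h := hz.add t u htu (c - 2 * l t - 2 * l u) (by push_cast; linear_combination h)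
  sub t u htu c h := hz.sub t u htu (c - 2 * l t + 2 * l u) (by push_cast; linear_combination h)

theorem extend_entry {A : Type*} [Zero A] (x : Entry n → A) (t : Entry n) :
    extend x t.1.1 t.1.2 = x t := by
  rw [extend, dif_pos t.2]

theorem extend_of_forall_ne {A : Type*} [Zero A] (x : Entry n → A) {i j : ℕ}
    (h : ∀ t : Entry n, t.1 ≠ (i, j)) : extend x i j = 0 := by
  rw [extend, dif_neg fun hmem => h ⟨(i, j), hmem⟩ rfl]

theorem entry_mem {n p k j : ℕ} (hp : p + 1 ≤ n) (hk : k ≤ (p + 1) / 2)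
    (hj : j ∈ Finset.Icc 1 k) :
    (p, j) ∈ (Finset.Icc 1 (n - 1) ×ˢ Finset.Icc 1 n).filter fun q => 2 * q.2 ≤ q.1 + 1 := by
  rw [Finset.mem_Icc] at hj
  rw [entry_iff]
  omega

theorem Generic.row {z : Entry n → K} (hz : Generic z) {p k : ℕ} (hp : p + 1 ≤ n)
    (hk : k ≤ (p + 1) / 2) : GenericRow k (extend z p) where
  entry i hi c := by
    rw [extend, dif_pos (entry_mem hp hk hi)]
    exact hz.entry _ c
  add i hi j hj hij c := by
    rw [extend, dif_pos (entry_mem hp hk hi), extend, dif_pos (entry_mem hp hk hj)]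
    exact hz.add _ _ (by simpa using hij) c
  sub i hi j hj hij c := by
    rw [extend, dif_pos (entry_mem hp hk hi), extend, dif_pos (entry_mem hp hk hj)]
    exact hz.sub _ _ (by simpa using hij) c

theorem Generic.signedEntry_ne [CharZero K] {z : Entry n → K} (hz : Generic z) {p q k k' : ℕ}
    (hpq : p ≠ q) (hp : p + 1 ≤ n) (hk : k ≤ (p + 1) / 2) (hq : q + 1 ≤ n)
    (hk' : k' ≤ (q + 1) / 2) {ε β : ℤ} (hε : ε ∈ Finset.Icc (-k : ℤ) k)
    (hβ : β ∈ Finset.Icc (-k' : ℤ) k') (h0 : ε ≠ 0 ∨ β ≠ 0) (c : ℤ) :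
    signedEntry (extend z p) ε - signedEntry (extend z q) β ≠ c / 2 := by
  rcases eq_or_ne ε 0 with rfl | hε0
  · have hβ0 : β ≠ 0 := by simpa using h0
    have hi := natAbs_mem hβ hβ0
    rw [signedEntry_zero, signedEntry_of_ne hβ0]
    have g := (hz.row hq hk').entry _ hi
    intro e
    rcases sign_cases hβ0 with h | h <;> rw [h] at e <;> push_cast at e
    · exact g (-1 - c) (by push_cast; linear_combination -e)
    · exact g (1 + c) (by push_cast; linear_combination e)
  have hj := natAbs_mem hε hε0
  rcases eq_or_ne β 0 with rfl | hβ0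
  · rw [signedEntry_zero, signedEntry_of_ne hε0]
    have g := (hz.row hp hk).entry _ hj
    intro e
    rcases sign_cases hε0 with h | h <;> rw [h] at e <;> push_cast at e
    · exact g (-1 + c) (by push_cast; linear_combination e)
    · exact g (1 - c) (by push_cast; linear_combination -e)
  have hi := natAbs_mem hβ hβ0
  rw [signedEntry_of_ne hε0, signedEntry_of_ne hβ0, extend, dif_pos (entry_mem hp hk hj), extend,
    dif_pos (entry_mem hq hk' hi)]
  have hne : (⟨(p, ε.natAbs), entry_mem hp hk hj⟩ : Entry n) ≠
      ⟨(q, β.natAbs), entry_mem hq hk' hi⟩ := by simp [hpq]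
  have ga := hz.add _ _ hne
  have gs := hz.sub _ _ hne
  intro e
  rcases sign_cases hε0 with h | h <;> rcases sign_cases hβ0 with h' | h' <;> rw [h, h'] at e <;>
    push_cast at e
  · exact gs c (by linear_combination e)
  · exact ga c (by linear_combination e)
  · exact ga (-c) (by push_cast; linear_combination -e)
  · exact gs (-c) (by push_cast; linear_combination -e)

theorem signedEntry_sub_neg [CharZero K] (x y : ℕ → K) (ε : ℤ) {β : ℤ} (h : β ≠ 0) :
    signedEntry x ε - signedEntry y (-β) = signedEntry x ε + signedEntry y β := by
  rw [signedEntry_of_ne h, signedEntry_of_ne (neg_ne_zero.2 h), Int.natAbs_neg, Int.sign_neg]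
  push_cast
  ring

theorem Generic.node_ne [CharZero K] {z : Entry n → K} (hz : Generic z) {p q k k' : ℕ}
    (hpq : p ≠ q) (hp : p + 1 ≤ n) (hk : k ≤ (p + 1) / 2) (hq : q + 1 ≤ n)
    (hk' : k' ≤ (q + 1) / 2) {ε β : ℤ} (hε : ε ∈ Finset.Icc (-k : ℤ) k)
    (hβ : β ∈ Finset.Icc (-k' : ℤ) k') (h0 : ε ≠ 0 ∨ β ≠ 0) :
    node (extend z p) ε - signedEntry (extend z q) β ^ 2 ≠ 0 := by
  have h1 := hz.signedEntry_ne hpq hp hk hq hk' hε hβ h0 (-1)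
  have h2 : signedEntry (extend z p) ε + signedEntry (extend z q) β + 1 / 2 ≠ 0 := by
    rcases eq_or_ne β 0 with rfl | hβ0
    · have h3 := hz.signedEntry_ne hpq hp hk hq hk' hε hβ h0 1
      rw [signedEntry_zero] at *
      intro e
      exact h3 (by push_cast; linear_combination e)
    · have h3 := hz.signedEntry_ne hpq hp hk hq hk' hε (neg_mem_signed hβ)
        (Or.inr (neg_ne_zero.2 hβ0)) (-1)
      rw [signedEntry_sub_neg _ _ _ hβ0] at h3
      intro e
      exact h3 (by push_cast; linear_combination e)
  rw [node, show ∀ a b : K, (a + 1 / 2) ^ 2 - b ^ 2 = (a - b + 1 / 2) * (a + b + 1 / 2) by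
    intros; ring]
  refine mul_ne_zero (fun e => h1 ?_) h2
  push_cast
  linear_combination e

theorem point_add_unitVec {p k : ℕ} (hp : p + 1 ≤ n) (hk : k ≤ (p + 1) / 2)
    {ε : ℤ} (hε : ε ∈ Finset.Icc (-k : ℤ) k) (z : Entry n → K) (l : Entry n → ℤ) :
    point z (l + unitVec n p ε) = bumpPoint p ε (point z l) := by
  funext i j
  have h0 : bumpPoint p ε (point z l) i j = point z l i j +
      if (i, j) = (p, ε.natAbs) then (ε.sign : K) else 0 := by
    by_cases hi : i = p
    · subst hi
      rw [bumpPoint_self, bump]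
      simp
    · rw [bumpPoint_of_ne hi]
      simp [hi]
  rw [h0]
  unfold point
  by_cases hmem : ∃ t : Entry n, t.1 = (i, j)
  · obtain ⟨t, ht⟩ := hmem
    obtain ⟨rfl, rfl⟩ := Prod.ext_iff.1 ht
    rw [extend_entry, extend_entry, Pi.add_apply, unitVec]
    push_cast
    rw [add_assoc]
  · rw [not_exists] at hmem
    rw [extend_of_forall_ne _ hmem, extend_of_forall_ne _ hmem, zero_add]
    split_ifs with hj
    · rcases eq_or_ne ε 0 with rfl | hε0
      · simp
      · exact absurd hj.symm (hmem ⟨_, entry_mem hp hk (natAbs_mem hε hε0)⟩)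
    · rfl

theorem unitVec_neg (p : ℕ) (ε : ℤ) : unitVec n p (-ε) = -unitVec n p ε := by
  funext t
  simp only [unitVec, Int.natAbs_neg, Int.sign_neg, Pi.neg_apply]
  split_ifs <;> simp

theorem unitVec_zero (p : ℕ) : unitVec n p 0 = 0 := by
  funext t
  simp [unitVec]

/-- The generator `I_{s+1,s}` on functions on the lattice around `z`. -/
def latticeGen [Algebra ℂ K] (z : Entry n → K) (s : ℕ) : Module.End K ((Entry n → ℤ) → K) :=
  diffOp (signedIdx s) (unitVec n (s - 1)) fun ε l => coef s (point z l) ε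

theorem signedEntry_sq_mem {k : ℕ} (x : ℕ → K) {β : ℤ} (hβ : β ∈ Finset.Icc (-k : ℤ) k)
    (h : β ≠ 0) : ∃ j ∈ Finset.Icc 1 k, signedEntry x β ^ 2 = x j ^ 2 := by
  refine ⟨β.natAbs, natAbs_mem hβ h, ?_⟩
  rw [signedEntry_of_ne h]
  rcases sign_cases h with e | e <;> rw [e] <;> push_cast <;> ring

theorem genPoly_eval_upper [CharZero K] (s : ℕ) (m : ℕ → ℕ → K) {β : ℤ}
    (hβ : β ∈ signedIdx (s + 1)) : (genPoly s m).eval (signedEntry (m s) β ^ 2) = 0 := by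
  have hβ' := mem_of_mem_signedIdx hβ
  unfold genPoly
  split_ifs with he
  · rw [oddPoly_eval]
    rcases eq_or_ne β 0 with rfl | h0
    · rw [signedEntry_zero]; norm_num
    · obtain ⟨j, hj, e⟩ := signedEntry_sq_mem (m s) hβ' h0
      have hs : (s + 1) / 2 = s / 2 := by obtain ⟨r, rfl⟩ := he; omega
      rw [hs] at hj
      rw [e, Finset.prod_eq_zero hj (sub_self _), mul_zero, mul_zero]
  · have h0 := ne_zero_of_mem_signedIdx (Nat.even_add_one.2 he) hβ
    obtain ⟨j, hj, e⟩ := signedEntry_sq_mem (m s) hβ' h0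
    rw [Nat.not_even_iff_odd] at he
    have hs : (s + 1) / 2 = s / 2 + 1 := by obtain ⟨r, rfl⟩ := he; omega
    rw [hs] at hj
    rw [evenPoly_eval, e, Finset.prod_eq_zero hj (sub_self _), mul_zero]

theorem genPoly_eval_lower [CharZero K] (s : ℕ) (m : ℕ → ℕ → K) {β : ℤ}
    (hβ : β ∈ signedIdx s) : (genPoly (s + 1) m).eval (signedEntry (m (s - 1)) β ^ 2) = 0 := by
  have hβ' := mem_of_mem_signedIdx hβ
  unfold genPoly
  rw [show s + 1 - 2 = s - 1 by omega]
  split_ifs with he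
  · rw [oddPoly_eval]
    rcases eq_or_ne β 0 with rfl | h0
    · rw [signedEntry_zero]; norm_num
    · obtain ⟨j, hj, e⟩ := signedEntry_sq_mem (m (s - 1)) hβ' h0
      have hs : s / 2 = (s + 1) / 2 - 1 := by obtain ⟨r, hr⟩ := he; omega
      rw [hs] at hj
      rw [e, Finset.prod_eq_zero hj (sub_self _), zero_mul, mul_zero]
  · have he' : Even s := by rwa [Nat.even_add_one, not_not] at he
    have h0 := ne_zero_of_mem_signedIdx he' hβ
    obtain ⟨j, hj, e⟩ := signedEntry_sq_mem (m (s - 1)) hβ' h0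
    have hs : s / 2 = (s + 1) / 2 := by obtain ⟨r, rfl⟩ := he'; omega
    rw [hs] at hj
    rw [evenPoly_eval, e, Finset.prod_eq_zero hj (sub_self _), zero_mul]

theorem point_add_of_mem {s : ℕ} (hs : 1 ≤ s) (hn : s ≤ n) {ε : ℤ} (hε : ε ∈ signedIdx s)
    (z : Entry n → K) (l : Entry n → ℤ) :
    point z (l + unitVec n (s - 1) ε) = bumpPoint (s - 1) ε (point z l) :=
  point_add_unitVec (by omega) (show s / 2 ≤ (s - 1 + 1) / 2 by omega)
    (mem_of_mem_signedIdx hε) z l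

theorem latticeGen_relations [CharZero K] [Algebra ℂ K] {z : Entry n → K} (hz : Generic z) :
    SatisfiesSoRelations n (latticeGen z) where
  serre_left s hs hn := by
    have hA : ∀ ε ∈ signedIdx s, ∀ l, point z (l + unitVec n (s - 1) ε) =
        bumpPoint (s - 1) ε (point z l) := fun ε hε l => point_add_of_mem hs (by omega) hε z l
    have hB : ∀ β ∈ signedIdx (s + 1), ∀ l, point z (l + unitVec n (s + 1 - 1) β) =
        bumpPoint s β (point z l) := fun β hβ l =>
      point_add_of_mem (by omega) (by omega) hβ z l
    refine diffOp_lie_lie (X := fun ε l => signedEntry (point z l (s - 1)) ε)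
      (Y := fun β l => signedEntry (point z l s) β) (fun ε => neg_mem_signedIdx)
      (unitVec_neg _) ?_ ?_ ?_ ?_ ?_ ?_ ?_ ?_
    · intro ε hε β hβ l
      rw [hA ε hε, bumpPoint_of_ne (by omega)]
    · intro ε hε δ hδ h h' l
      rw [hA ε hε, bumpPoint_self, signedEntry_bump_of_ne _ h h']
    · intro ε hε h l
      rw [hA ε hε, bumpPoint_self, signedEntry_bump_self _ h]
    · intro ε hε l
      rw [hA ε hε, bumpPoint_self, signedEntry_neg_bump]
    · intro ε hε β hβ l e
      refine (hz.translate l).signedEntry_ne (show s - 1 ≠ s by omega) (by omega)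
        (show s / 2 ≤ _ by omega) (by omega) le_rfl (mem_of_mem_signedIdx hε)
        (mem_of_mem_signedIdx hβ) (ne_zero_or_ne_zero hε hβ) (-1)
        (show signedEntry (point z l (s - 1)) ε - signedEntry (point z l s) β = _ from ?_)
      push_cast
      linear_combination e
    · intro ε hε β hβ l
      rw [hA ε hε, hB β hβ]
      exact coef_mul_coef hs _ hε hβ
    · intro ε hε δ hδ h h' l
      rw [hA ε hε, hA δ hδ]
      exact coef_antisymm hs ((hz.translate l).row (by omega) (by omega)) hε hδ h h'
    · intro β hβ l
      refine Eq.trans (Finset.sum_congr rfl ?_) (coef_sum hs ((hz.translate l).row (by omega) (by omega)) _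
        (genPoly_eval_upper s (point z l) hβ) fun ε hε =>
          (hz.translate l).node_ne (show s - 1 ≠ s by omega) (by omega)
            (show s / 2 ≤ _ by omega) (by omega) le_rfl (mem_of_mem_signedIdx hε)
            (mem_of_mem_signedIdx hβ) (ne_zero_or_ne_zero hε hβ))
      intro ε hε
      rw [hA ε hε]
      rfl
  serre_right s hs hn := by
    have hA : ∀ ε ∈ signedIdx s, ∀ l, point z (l + unitVec n (s - 1) ε) =
        bumpPoint (s - 1) ε (point z l) := fun ε hε l => point_add_of_mem hs (by omega) hε z l
    have hB : ∀ β ∈ signedIdx (s + 1), ∀ l, point z (l + unitVec n (s + 1 - 1) β) =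
        bumpPoint s β (point z l) := fun β hβ l =>
      point_add_of_mem (by omega) (by omega) hβ z l
    refine diffOp_lie_lie (Y := fun ε l => signedEntry (point z l (s - 1)) ε)
      (X := fun β l => signedEntry (point z l s) β) (fun ε => neg_mem_signedIdx)
      (unitVec_neg _) ?_ ?_ ?_ ?_ ?_ ?_ ?_ ?_
    · intro β hβ ε hε l
      rw [hB β hβ, bumpPoint_of_ne (by omega)]
    · intro ε hε δ hδ h h' l
      rw [hB ε hε, bumpPoint_self, signedEntry_bump_of_ne _ h h']
    · intro ε hε h l
      rw [hB ε hε, bumpPoint_self, signedEntry_bump_self _ h]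
    · intro ε hε l
      rw [hB ε hε, bumpPoint_self, signedEntry_neg_bump]
    · intro β hβ ε hε l e
      refine (hz.translate l).signedEntry_ne (show s ≠ s - 1 by omega) (by omega)
        le_rfl (by omega) (show s / 2 ≤ _ by omega) (mem_of_mem_signedIdx hβ)
        (mem_of_mem_signedIdx hε) (ne_zero_or_ne_zero hε hβ).symm (-1)
        (show signedEntry (point z l s) β - signedEntry (point z l (s - 1)) ε = _ from ?_)
      push_cast
      linear_combination e
    · intro β hβ ε hε l
      rw [hA ε hε, hB β hβ]
      linear_combination coef_mul_coef hs (point z l) hε hβ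
    · intro ε hε δ hδ h h' l
      rw [hB ε hε, hB δ hδ]
      exact coef_antisymm (s := s + 1) (by omega) ((hz.translate l).row (by omega) (by omega))
        hε hδ h h'
    · intro ε hε l
      refine Eq.trans (Finset.sum_congr rfl ?_) (coef_sum (s := s + 1) (by omega) ((hz.translate l).row (by omega) (by omega)) _
        (genPoly_eval_lower s (point z l) hε) fun β hβ =>
          (hz.translate l).node_ne (show s ≠ s - 1 by omega) (by omega)
            le_rfl (by omega) (show s / 2 ≤ _ by omega) (mem_of_mem_signedIdx hβ)
            (mem_of_mem_signedIdx hε) (ne_zero_or_ne_zero hε hβ).symm)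
      intro β hβ
      rw [hB β hβ]
      rfl
  comm i j hi hin hj hjn hij := by
    have hA : ∀ s, 1 ≤ s → s + 1 ≤ n → ∀ ε ∈ signedIdx s, ∀ l,
        point z (l + unitVec n (s - 1) ε) = bumpPoint (s - 1) ε (point z l) :=
      fun s h h' ε hε l => point_add_of_mem h (by omega) hε z l
    have hij' : i + 2 ≤ j ∨ j + 2 ≤ i := by
      rcases abs_cases ((i : ℤ) - j) with h | h <;> omega
    refine diffOp_lie_eq_zero ?_ ?_
    · intro ε hε β hβ l
      rw [hA j hj hjn β hβ, coef_congr]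
      all_goals exact bumpPoint_of_ne (by omega) _ _
    · intro ε hε β hβ l
      rw [hA i hi hin ε hε, coef_congr]
      all_goals exact bumpPoint_of_ne (by omega) _ _

end Lattice


/-! ### Evaluation of the generators at points -/

section Evaluation

variable {A K : Type*} [CommRing A] [Div A] [Algebra ℂ A] [Field K] [Algebra ℂ K]

theorem sum_erase_signed {M : Type*} [AddCommGroup M] (k : ℕ) (f : ℤ → M) :
    ∑ ε ∈ (Finset.Icc (-k : ℤ) k).erase 0, f ε =
      (∑ j ∈ Finset.Icc 1 k, f j) + ∑ j ∈ Finset.Icc 1 k, f (-j) := by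
  have h : (0 : ℤ) ∈ Finset.Icc (-k : ℤ) k := by simp
  rw [← add_left_inj (f 0), Finset.sum_erase_add _ _ h, sum_signed]

theorem map_gen (φ : A →ₐ[ℂ] K) (hφ : ∀ f g, φ (f / g) = φ f / φ g) (m : ℕ → ℕ → A)
    (T : ℕ → ℕ → ℂ → Module.End ℂ A) (s : ℕ) (f : A) :
    φ (gen m T s f) = ∑ ε ∈ signedIdx s, coef s (fun i j => φ (m i j)) ε *
      φ (if ε = 0 then f else T (s - 1) ε.natAbs ε.sign f) := by
  have hpos : ∀ j ∈ Finset.Icc 1 (s / 2), (j : ℤ) ≠ 0 ∧ (j : ℤ).sign = 1 := by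
    intro j hj
    have h0 : j ≠ 0 := by
      have := (Finset.mem_Icc.1 hj).1
      omega
    exact ⟨by omega, Int.sign_natCast_of_ne_zero h0⟩
  rcases Nat.even_or_odd' s with ⟨k, rfl | rfl⟩
  · have he : Even (2 * k) := even_two_mul k
    have hk : 2 * k / 2 = k := by omega
    rw [gen, if_pos he, coef, if_pos he, signedIdx, if_pos he,
      sum_erase_signed]
    simp only [hk] at hpos ⊢
    simp only [genOdd, LinearMap.sub_apply, LinearMap.neg_apply, LinearMap.sum_apply,
      Module.End.mul_apply, LinearMap.mulLeft_apply, map_sub, map_neg, map_sum, map_mul]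
    rw [sub_eq_add_neg, ← Finset.sum_neg_distrib, ← Finset.sum_neg_distrib]
    congr 1
    · refine Finset.sum_congr rfl fun j hj => ?_
      obtain ⟨h0, h1⟩ := hpos j hj
      rw [oddCoef, signedCoef_of_ne h0, if_neg h0, h1, Int.natAbs_natCast, oddNum, if_pos rfl,
        ← neg_mul]
      push_cast
      congr 1
      simp only [oddUp, oddDen, hφ, map_mul, map_prod, map_add, map_sub, map_one, map_ofNat]
      push_cast
      ring
    · refine Finset.sum_congr rfl fun j hj => ?_
      obtain ⟨h0, h1⟩ := hpos j hj
      rw [oddCoef, signedCoef_of_ne (neg_ne_zero.2 h0), if_neg (neg_ne_zero.2 h0), Int.sign_neg,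
        h1, Int.natAbs_neg, Int.natAbs_natCast, oddNum, if_neg (by decide), ← neg_mul]
      push_cast
      congr 1
      simp only [oddDown, oddDen, hφ, map_mul, map_prod, map_add, map_sub, map_one, map_ofNat]
      push_cast
      simp only [← sub_eq_add_neg]
      ring
  · have he : ¬ Even (2 * k + 1) := by simp
    have hk : (2 * k + 1) / 2 = k := by omega
    rw [gen, if_neg he, coef, if_neg he, signedIdx, if_neg he, sum_signed]
    simp only [hk] at hpos ⊢
    simp only [genEven, LinearMap.add_apply, LinearMap.smul_apply, LinearMap.sum_apply,
      Module.End.mul_apply, LinearMap.mulLeft_apply, map_add, map_sum, map_mul, map_smul]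
    congr 1
    · congr 1
      · refine Finset.sum_congr rfl fun j hj => ?_
        obtain ⟨h0, h1⟩ := hpos j hj
        rw [evenCoef, signedCoef_of_ne h0, if_neg h0, h1, Int.natAbs_natCast, evenNum, if_pos rfl]
        push_cast
        congr 1
        simp only [evenUp, evenDen, hφ, map_mul, map_prod, map_add, map_sub, map_one,
          map_ofNat, map_pow]
        rw [div_div]
      · refine Finset.sum_congr rfl fun j hj => ?_
        obtain ⟨h0, h1⟩ := hpos j hj
        rw [evenCoef, signedCoef_of_ne (neg_ne_zero.2 h0), if_neg (neg_ne_zero.2 h0),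
          Int.sign_neg, h1, Int.natAbs_neg, Int.natAbs_natCast, evenNum, if_neg (by decide)]
        push_cast
        congr 1
        simp only [evenDown, evenDen, hφ, map_mul, map_prod, map_sub, map_one, map_ofNat,
          map_pow]
        rw [div_div]
    · rw [if_pos trivial, evenCoef, signedCoef_zero, Algebra.smul_def, mul_assoc]
      simp only [evenDiag, hφ, map_mul, map_prod, map_add, map_sub, map_one,
          map_ofNat, show 2 * k + 1 - 2 = 2 * k - 1 by omega, Nat.add_sub_cancel]

variable {n : ℕ}

/-- The generators in an algebra with evaluations at the points of a lattice are mapped to those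
on functions on the lattice. -/
theorem eval_gen (z : Entry n → K) (φ : (Entry n → ℤ) → A →ₐ[ℂ] K)
    (hφ : ∀ l f g, φ l (f / g) = φ l f / φ l g) (m : ℕ → ℕ → A)
    (hm : ∀ l i j, φ l (m i j) = point z l i j) (T : ℕ → ℕ → ℂ → Module.End ℂ A)
    (hT : ∀ l (t : Entry n) (c : ℤ) f, φ l (T t.1.1 t.1.2 c f) =
      φ (l + fun u => if u = t then c else 0) f) {s : ℕ} (hn : s + 1 ≤ n) (f : A) :
    (fun l => φ l (gen m T s f)) = latticeGen z s fun l => φ l f := by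
  funext l
  rw [latticeGen, diffOp_apply, map_gen (φ l) (hφ l)]
  refine Finset.sum_congr rfl fun ε hε => ?_
  rw [show (fun i j => φ l (m i j)) = point z l from funext fun i => funext fun j => hm l i j]
  congr 1
  split_ifs with h0
  · rw [h0, unitVec_zero, add_zero]
  · have hmem : (s - 1, ε.natAbs) ∈ (Finset.Icc 1 (n - 1) ×ˢ Finset.Icc 1 n).filter
        fun q => 2 * q.2 ≤ q.1 + 1 :=
      entry_mem (by omega) (show s / 2 ≤ _ by omega) (natAbs_mem (mem_of_mem_signedIdx hε) h0)
    rw [hT l ⟨(s - 1, ε.natAbs), hmem⟩ ε.sign f]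
    congr 2
    funext u
    simp [unitVec, Subtype.ext_iff]

/-- Transfer of relations along a map intertwining two families of operators. -/
theorem relations_transfer {R V W : Type*} [CommRing R] [AddCommGroup V] [Module ℂ V]
    [AddCommGroup W] [Module R W] {G : ℕ → Module.End ℂ V} {D : ℕ → Module.End R W}
    (hD : SatisfiesSoRelations n D) (Ψ : V →+ W)
    (hΨ : ∀ s, s + 1 ≤ n → ∀ v, Ψ (G s v) = D s (Ψ v)) :
    (∀ i, 1 ≤ i → i + 2 ≤ n → ∀ v, Ψ ((⁅G i, ⁅G (i + 1), G i⁆⁆ - G (i + 1)) v) = 0) ∧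
    (∀ i, 1 ≤ i → i + 2 ≤ n → ∀ v, Ψ ((⁅G (i + 1), ⁅G i, G (i + 1)⁆⁆ - G i) v) = 0) ∧
    (∀ i j, 1 ≤ i → i + 1 ≤ n → 1 ≤ j → j + 1 ≤ n → 1 < |(i : ℤ) - (j : ℤ)| →
      ∀ v, Ψ (⁅G i, G j⁆ v) = 0) := by
  refine ⟨fun i hi hn v => ?_, fun i hi hn v => ?_, fun i j hi hin hj hjn hij v => ?_⟩
  · have h := LinearMap.congr_fun (hD.serre_left i hi hn) (Ψ v)
    rw [← sub_eq_zero] at h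
    rw [← h]
    simp only [Ring.lie_def, LinearMap.sub_apply, Module.End.mul_apply, map_sub,
      hΨ i (by omega), hΨ (i + 1) (by omega)]
  · have h := LinearMap.congr_fun (hD.serre_right i hi hn) (Ψ v)
    rw [← sub_eq_zero] at h
    rw [← h]
    simp only [Ring.lie_def, LinearMap.sub_apply, Module.End.mul_apply, map_sub,
      hΨ i (by omega), hΨ (i + 1) (by omega)]
  · have h := LinearMap.congr_fun (hD.comm i j hi hin hj hjn hij) (Ψ v)
    rw [LinearMap.zero_apply] at h
    rw [← h]
    simp only [Ring.lie_def, LinearMap.sub_apply, Module.End.mul_apply, map_sub, hΨ i hin, hΨ j hjn]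

end Evaluation

/-! ### Rational functions -/

section Rational

variable {n : ℕ}

/-- The simultaneous substitution `m_t ↦ m_t + v_t` in polynomials. -/
def translatePoly (v : Entry n → ℂ) : Poly n →ₐ[ℂ] Poly n :=
  MvPolynomial.aeval fun t => MvPolynomial.X t + MvPolynomial.C (v t)

theorem translatePoly_comp (v w : Entry n → ℂ) :
    (translatePoly v).comp (translatePoly w) = translatePoly (v + w) := by
  apply MvPolynomial.algHom_ext
  intro t
  simp only [translatePoly, AlgHom.comp_apply, MvPolynomial.aeval_X, map_add,
    MvPolynomial.algHom_C, MvPolynomial.algebraMap_eq, Pi.add_apply, add_assoc]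

theorem translatePoly_zero : translatePoly (0 : Entry n → ℂ) = AlgHom.id ℂ (Poly n) := by
  apply MvPolynomial.algHom_ext
  intro t
  simp [translatePoly]

theorem translatePoly_injective (v : Entry n → ℂ) : Function.Injective
    ((IsScalarTower.toAlgHom ℂ (Poly n) (RatFun n)).comp (translatePoly v)) := by
  refine (IsFractionRing.injective (Poly n) (RatFun n)).comp
    (Function.LeftInverse.injective (g := translatePoly (-v)) fun p => ?_)
  have h := DFunLike.congr_fun (translatePoly_comp (-v) v) p
  rw [neg_add_cancel, translatePoly_zero] at h
  exact h

/-- The simultaneous translation of the variables in rational functions. -/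
def translateRat (v : Entry n → ℂ) : RatFun n →ₐ[ℂ] RatFun n :=
  IsFractionRing.liftAlgHom (translatePoly_injective v)

theorem translateRat_algebraMap (v : Entry n → ℂ) (p : Poly n) :
    translateRat v (algebraMap (Poly n) (RatFun n) p) =
      algebraMap (Poly n) (RatFun n) (translatePoly v p) :=
  IsFractionRing.lift_algebraMap (translatePoly_injective v) p

theorem shiftRat_algebraMap (i j : ℕ) (a : ℂ) (p : Poly n) :
    shiftRat n i j a (algebraMap (Poly n) (RatFun n) p) =
      algebraMap (Poly n) (RatFun n) (shiftPoly n i j a p) :=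
  IsFractionRing.lift_algebraMap (shiftPoly_injective n i j a) p

theorem shiftRat_div (i j : ℕ) (a : ℂ) (f g : RatFun n) :
    shiftRat n i j a (f / g) = shiftRat n i j a f / shiftRat n i j a g :=
  map_div₀ (IsFractionRing.liftAlgHom (shiftPoly_injective n i j a) : RatFun n →ₐ[ℂ] RatFun n) f g

theorem translateRat_shiftRat (v : Entry n → ℂ) (t : Entry n) (a : ℂ) (f : RatFun n) :
    translateRat v (shiftRat n t.1.1 t.1.2 a f) =
      translateRat (v + fun u => if u = t then a else 0) f := by
  have h : shiftPoly n t.1.1 t.1.2 a = translatePoly fun u => if u = t then a else 0 := by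
    unfold shiftPoly translatePoly
    congr 1
    funext u
    simp only [Prod.mk.eta, Subtype.ext_iff]
  obtain ⟨p, q, -, rfl⟩ := IsFractionRing.div_surjective (Poly n) f
  rw [shiftRat_div, map_div₀, map_div₀, shiftRat_algebraMap, shiftRat_algebraMap,
    translateRat_algebraMap, translateRat_algebraMap, translateRat_algebraMap,
    translateRat_algebraMap, h, ← translatePoly_comp]
  rfl

theorem translateRat_zero (f : RatFun n) : translateRat 0 f = f := by
  obtain ⟨p, q, -, rfl⟩ := IsFractionRing.div_surjective (Poly n) f
  rw [map_div₀, translateRat_algebraMap, translateRat_algebraMap, translatePoly_zero]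
  rfl

theorem algebraMap_ne_half {p : Poly n} (x : ℂ → Entry n → ℂ)
    (hx : ∀ a, MvPolynomial.eval (x a) p = a) (c : ℤ) :
    algebraMap (Poly n) (RatFun n) p ≠ c / 2 := by
  intro h
  have h1 : algebraMap (Poly n) (RatFun n) (2 * p) = algebraMap (Poly n) (RatFun n) c := by
    rw [map_mul, h, map_ofNat, map_intCast]
    field_simp
  have h2 := congrArg (MvPolynomial.eval (x (c / 2 + 1)))
    (IsFractionRing.injective (Poly n) (RatFun n) h1)
  rw [map_mul, hx, map_ofNat, map_intCast] at h2
  exact two_ne_zero (α := ℂ) (by linear_combination h2)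

theorem generic_rat :
    Generic fun t : Entry n => algebraMap (Poly n) (RatFun n) (MvPolynomial.X t) where
  entry t := algebraMap_ne_half (fun a u => if u = t then a else 0) (by simp)
  add t u h c := by
    rw [← map_add]
    exact algebraMap_ne_half (fun a v => if v = t then a else 0) (by simp [h.symm]) c
  sub t u h c := by
    rw [← map_sub]
    exact algebraMap_ne_half (fun a v => if v = t then a else 0) (by simp [h.symm]) c

theorem charZero_ratFun : CharZero (RatFun n) :=
  charZero_of_injective_algebraMap (algebraMap ℂ (RatFun n)).injective

theorem genRat_relations (n : ℕ) : SatisfiesSoRelations n (genRat n) := by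
  have := charZero_ratFun (n := n)
  set z : Entry n → RatFun n := fun t => algebraMap (Poly n) (RatFun n) (MvPolynomial.X t)
  set φ : (Entry n → ℤ) → RatFun n →ₐ[ℂ] RatFun n := fun l => translateRat fun t => (l t : ℂ)
  have hm : ∀ l i j, φ l (varRat n i j) = point z l i j := by
    intro l i j
    unfold varRat point
    by_cases hmem : ∃ t : Entry n, t.1 = (i, j)
    · obtain ⟨t, ht⟩ := hmem
      obtain ⟨rfl, rfl⟩ := Prod.ext_iff.1 ht
      rw [extend_entry, extend_entry, translateRat_algebraMap]
      simp [translatePoly, z]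
    · rw [not_exists] at hmem
      rw [extend_of_forall_ne _ hmem, extend_of_forall_ne _ hmem, map_zero]
  have hT : ∀ l (t : Entry n) (c : ℤ) f, φ l (shiftRat n t.1.1 t.1.2 c f) =
      φ (l + fun u => if u = t then c else 0) f := by
    intro l t c f
    rw [translateRat_shiftRat]
    congr 2
    funext u
    simp
  let Ψ : RatFun n →+ ((Entry n → ℤ) → RatFun n) :=
    { toFun := fun f l => φ l f
      map_zero' := funext fun l => map_zero (φ l)
      map_add' := fun f g => funext fun l => map_add (φ l) f g }
  have hΨ : ∀ f, Ψ f = 0 → f = 0 := by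
    intro f hf
    have h0 : translateRat 0 f = 0 := by
      have h := congrFun hf 0
      change translateRat (fun t => (((0 : Entry n → ℤ) t : ℤ) : ℂ)) f = 0 at h
      rwa [show (fun t : Entry n => (((0 : Entry n → ℤ) t : ℤ) : ℂ)) = 0 by
        funext t; simp] at h
    rwa [translateRat_zero] at h0
  obtain ⟨h1, h2, h3⟩ := relations_transfer (G := genRat n) (latticeGen_relations generic_rat) Ψ
    fun s hs f => eval_gen z φ (fun l f g => map_div₀ (φ l) f g) _ hm _ hT hs f
  exact ⟨fun i hi hn => sub_eq_zero.1 (LinearMap.ext fun f => hΨ _ (h1 i hi hn f)),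
    fun i hi hn => sub_eq_zero.1 (LinearMap.ext fun f => hΨ _ (h2 i hi hn f)),
    fun i j hi hin hj hjn hij => LinearMap.ext fun f => hΨ _ (h3 i j hi hin hj hjn hij f)⟩

end Rational

/-! ### Meromorphic functions -/

section Meromorphic

variable {n : ℕ}

theorem isClosed_halfIntegers : IsClosed (Set.range fun c : ℤ => (c : ℂ) / 2) := by
  have h : (Set.range fun c : ℤ => (c : ℂ) / 2) =
      (fun w : ℂ => 2 * w) ⁻¹' Set.range ((↑) : ℤ → ℂ) := by
    ext w
    simp only [Set.mem_range, Set.mem_preimage]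
    refine exists_congr fun c => ?_
    rw [div_eq_iff (two_ne_zero), mul_comm w]
  rw [h]
  exact Complex.isClosed_range_intCast.preimage (continuous_const_mul 2)

theorem dense_halfIntegers_compl : Dense (Set.range fun c : ℤ => (c : ℂ) / 2)ᶜ :=
  (Set.countable_range _).dense_compl ℝ

theorem isOpen_dense_preimage (g : Space n →L[ℂ] ℂ) (hg : g ≠ 0) :
    IsOpen {z | ∀ c : ℤ, g z ≠ c / 2} ∧ Dense {z | ∀ c : ℤ, g z ≠ c / 2} := by
  have h : {z | ∀ c : ℤ, g z ≠ c / 2} = g ⁻¹' (Set.range fun c : ℤ => (c : ℂ) / 2)ᶜ := by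
    ext z
    simp [eq_comm]
  rw [h]
  have hs : Function.Surjective g := LinearMap.surjective (f := (g : Space n →ₗ[ℂ] ℂ))
    fun h0 => hg (ContinuousLinearMap.coe_injective h0)
  exact ⟨isClosed_halfIntegers.isOpen_compl.preimage g.continuous,
    dense_halfIntegers_compl.preimage (g.isOpenMap hs)⟩

theorem isOpen_dense_iInter {ι : Type*} [Finite ι] {U : ι → Set (Space n)}
    (hU : ∀ i, IsOpen (U i) ∧ Dense (U i)) : IsOpen (⋂ i, U i) ∧ Dense (⋂ i, U i) :=
  ⟨isOpen_iInter_of_finite fun i => (hU i).1,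
    dense_iInter_of_isOpen (fun i => (hU i).1) fun i => (hU i).2⟩

theorem isOpen_dense_generic :
    IsOpen {z : Space n | Generic z} ∧ Dense {z : Space n | Generic z} := by
  let π : Entry n → Space n →L[ℂ] ℂ := fun t =>
    ContinuousLinearMap.proj (R := ℂ) (φ := fun _ : Entry n => ℂ) t
  have hπ : ∀ t u, π t (Pi.single u 1) = if t = u then 1 else 0 := by
    intro t u
    simp [π, Pi.single_apply]
  have h1 := isOpen_dense_iInter fun t : Entry n => isOpen_dense_preimage (π t) fun h => by
    have := hπ t t
    simp [h] at this
  have h2 := isOpen_dense_iInter fun q : {q : Entry n × Entry n // q.1 ≠ q.2} =>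
    isOpen_dense_preimage (π q.1.1 + π q.1.2) fun h => by
      have : (π q.1.1 + π q.1.2) (Pi.single q.1.1 1) = 1 := by
        rw [add_apply, hπ, hπ, if_pos rfl, if_neg q.2.symm, add_zero]
      simp [h] at this
  have h3 := isOpen_dense_iInter fun q : {q : Entry n × Entry n // q.1 ≠ q.2} =>
    isOpen_dense_preimage (π q.1.1 - π q.1.2) fun h => by
      have : (π q.1.1 - π q.1.2) (Pi.single q.1.1 1) = 1 := by
        rw [sub_apply, hπ, hπ, if_pos rfl, if_neg q.2.symm, sub_zero]
      simp [h] at this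
  have h : {z : Space n | Generic z} = (⋂ t, {z | ∀ c : ℤ, π t z ≠ c / 2}) ∩
      ((⋂ q : {q : Entry n × Entry n // q.1 ≠ q.2},
        {z | ∀ c : ℤ, (π q.1.1 + π q.1.2) z ≠ c / 2}) ∩
      ⋂ q : {q : Entry n × Entry n // q.1 ≠ q.2},
        {z | ∀ c : ℤ, (π q.1.1 - π q.1.2) z ≠ c / 2}) := by
    ext z
    simp only [Set.mem_inter_iff, Set.mem_iInter, Set.mem_ofPred_eq]
    exact ⟨fun h => ⟨h.entry, fun q => h.add _ _ q.2, fun q => h.sub _ _ q.2⟩,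
      fun h => ⟨h.1, fun t u htu => h.2.1 ⟨(t, u), htu⟩, fun t u htu => h.2.2 ⟨(t, u), htu⟩⟩⟩
  rw [h]
  exact ⟨h1.1.inter (h2.1.inter h3.1),
    h1.2.inter_of_isOpen_left (h2.2.inter_of_isOpen_left h3.2 h2.1) h1.1⟩

/-- The values of a function on the lattice around `z`. -/
def latticeValues (z : Space n) : (Space n → ℂ) →+ ((Entry n → ℤ) → ℂ) where
  toFun f l := f fun t => z t + l t
  map_zero' := rfl
  map_add' _ _ := rfl

theorem latticeValues_genFun (z : Space n) {s : ℕ} (hs : s + 1 ≤ n) (f : Space n → ℂ) :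
    latticeValues z (genFun n s f) = latticeGen z s (latticeValues z f) := by
  refine eval_gen z
    (fun l => Pi.evalAlgHom ℂ (fun _ : Space n => ℂ) fun t => z t + l t) (fun _ _ _ => rfl) _
    ?_ _ ?_ hs f
  · intro l i j
    unfold varFun point
    by_cases hmem : ∃ t : Entry n, t.1 = (i, j)
    · obtain ⟨t, ht⟩ := hmem
      obtain ⟨rfl, rfl⟩ := Prod.ext_iff.1 ht
      rw [extend_entry, extend_entry]
      rfl
    · rw [not_exists] at hmem
      rw [extend_of_forall_ne _ hmem, extend_of_forall_ne _ hmem, map_zero]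
  · intro l t c f
    change f (translate t.1.1 t.1.2 c fun t => z t + l t) =
      f fun u => z u + ((l + fun u => if u = t then c else 0) u : ℤ)
    congr 1
    funext u
    change z u + l u + (if u.1 = (t.1.1, t.1.2) then (c : ℂ) else 0) =
      z u + ((l u + if u = t then c else 0 : ℤ) : ℂ)
    push_cast
    rw [add_assoc]
    simp only [Prod.mk.eta, Subtype.ext_iff]

theorem eq_zero_of_generic {f : Space n → ℂ} (hf : ∀ z, Generic z → latticeValues z f = 0) :
    f ∈ genericNull n := by
  refine ⟨_, isOpen_dense_generic.1, isOpen_dense_generic.2, fun z hz => ?_⟩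
  simpa [latticeValues] using congrFun (hf z hz) 0

/-- The operator `P` on meromorphic functions is induced by the operator `Q` on functions. -/
def Induces (Q : Module.End ℂ (Space n → ℂ)) (P : Module.End ℂ (Mero n)) : Prop :=
  ∀ f : MeroFun n, ∃ h : Q f.1 ∈ MeroFun n,
    P (Submodule.Quotient.mk f) = Submodule.Quotient.mk ⟨Q f.1, h⟩

theorem induces_genMero (s : ℕ) : Induces (genFun n s) (genMero n s) := fun f =>
  ⟨genFun_mem_mero s f.1 f.2, rfl⟩

theorem Induces.mul {Q Q' : Module.End ℂ (Space n → ℂ)} {P P' : Module.End ℂ (Mero n)}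
    (h : Induces Q P) (h' : Induces Q' P') : Induces (Q * Q') (P * P') := by
  intro f
  obtain ⟨m', e'⟩ := h' f
  obtain ⟨m, e⟩ := h ⟨_, m'⟩
  exact ⟨m, by rw [Module.End.mul_apply, e', e]; rfl⟩

theorem Induces.sub {Q Q' : Module.End ℂ (Space n → ℂ)} {P P' : Module.End ℂ (Mero n)}
    (h : Induces Q P) (h' : Induces Q' P') : Induces (Q - Q') (P - P') := by
  intro f
  obtain ⟨m, e⟩ := h f
  obtain ⟨m', e'⟩ := h' f
  exact ⟨(MeroFun n).sub_mem m m', by rw [LinearMap.sub_apply, e, e']; rfl⟩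

theorem Induces.lie {Q Q' : Module.End ℂ (Space n → ℂ)} {P P' : Module.End ℂ (Mero n)}
    (h : Induces Q P) (h' : Induces Q' P') : Induces ⁅Q, Q'⁆ ⁅P, P'⁆ :=
  (h.mul h').sub (h'.mul h)

theorem Induces.eq_zero {Q : Module.End ℂ (Space n → ℂ)} {P : Module.End ℂ (Mero n)}
    (h : Induces Q P) (hQ : ∀ z, Generic z → ∀ f, latticeValues z (Q f) = 0) : P = 0 := by
  refine LinearMap.ext fun x => ?_
  obtain ⟨f, rfl⟩ := Submodule.Quotient.mk_surjective _ x
  obtain ⟨m, e⟩ := h f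
  rw [e, LinearMap.zero_apply, Submodule.Quotient.mk_eq_zero]
  exact eq_zero_of_generic fun z hz => hQ z hz f.1

theorem genMero_relations (n : ℕ) : SatisfiesSoRelations n (genMero n) := by
  have key := fun (z : Space n) (hz : Generic z) =>
    relations_transfer (G := genFun n) (latticeGen_relations hz) (latticeValues z)
      fun s hs => latticeValues_genFun z hs
  have hI := fun s => induces_genMero (n := n) s
  exact ⟨fun i hi hn => sub_eq_zero.1 (((hI i).lie ((hI (i + 1)).lie (hI i))).sub
      (hI (i + 1)) |>.eq_zero fun z hz => (key z hz).1 i hi hn),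
    fun i hi hn => sub_eq_zero.1 (((hI (i + 1)).lie ((hI i).lie (hI (i + 1)))).sub
      (hI i) |>.eq_zero fun z hz => (key z hz).2.1 i hi hn),
    fun i j hi hin hj hjn hij => ((hI i).lie (hI j)).eq_zero
      fun z hz => (key z hz).2.2 i j hi hin hj hjn hij⟩

end Meromorphic

end GelfandTsetlinSO

end

theorem proposition1 (n : ℕ) :
    GelfandTsetlinSO.SatisfiesSoRelations n (GelfandTsetlinSO.genRat n) ∧
      GelfandTsetlinSO.SatisfiesSoRelations n (GelfandTsetlinSO.genMero n) :=
  ⟨GelfandTsetlinSO.genRat_relations n, GelfandTsetlinSO.genMero_relations n⟩
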